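/- Let $L$ and $S$ be finite-dimensional quantum systems ($L\neq 0$) with Hermitian operators $H_L$ (logical Hamiltonian) and $H_S$ (physical Hamiltonian). Let $\mathcal E(\rho)=W\rho W^\dagger$ with $W^\dagger W=\mathbb 1$ be an isometric encoding of $L$ into $S$, and let $\mathcal N(\rho)=\sum_i K_i\rho K_i^\dagger$, $\sum_i K_i^\dagger K_i=\mathbb 1$, be a noise channel on $S$ (its output space may be $S$ or another finite-dimensional space), with finitely many Kraus operators. Suppose that the "Hamiltonian-in-Kraus-span" (HKS) condition $H_S\in\operatorname{span}_{\mathbb C}\{K_i^\dagger K_j : i,j\}$ holds. Notation. For Hermitian $A$, $\Delta A$ is the difference between its largest and smallest eigenvalues. The fidelity of states is $f(\rho,\sigma)=\operatorname{Tr}\sqrt{\rho^{1/2}\sigma\rho^{1/2}}$; that of channels is $f(\Phi_1,\Phi_2)=\min_\rho f((\Phi_1\otimes\mathbb 1)(\rho),(\Phi_2\otimes\mathbb 1)(\rho))$, where $\rho$ runs over the states of the input system together with a reference system of the same dimension; and $P(\Phi_1,\Phi_2)=\sqrt{1-f(\Phi_1,\Phi_2)^2}$. Put $$\epsilon=\min_{\mathcal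 R}P(\mathcal R\circ\mathcal N\circ\mathcal E,\mathbb 1_L),\qquad \mathfrak J=\min\Big\{\Delta h : h=h^\dagger,\ H_S=\sum_{ij}h_{ij}K_i^\dagger K_j\Big\},$$ where $\mathcal R$ runs over all channels (completely positive trace-preserving maps) from the output space of $\mathcal N$ to $L$, and $$\delta_{\mathrm C}=\Delta\big(H_L-\mathcal E^\dagger(H_S)\big),\qquad \delta_{\mathrm P}=\sqrt{2\,\partial_\theta^2\,P\big(\mathcal U_{S,\theta}\circ\mathcal E\circ\mathcal U_{L,\theta}^\dagger,\ \mathcal E\big)^2\Big|_{\theta=0}},$$ where $\mathcal E^\dagger$ is the dual map, $\mathcal U_{X,\theta}(\rho)=e^{-iH_X\theta}\rho\, e^{iH_X\theta}$ for $X=L,S$, and $\partial_\theta^2 g|_{\theta=0}$ is the number $s$ with $g(\theta)=g(0)+a\theta+\tfrac s2\theta^2+o(\theta^2)$ for some $a$. Then the second derivative in the definition of $\delta_{\mathrm P}$ exists, and $$\delta_{\mathrm P}+2\epsilon\,\mathfrak J\ \ge\ \Delta H_L,\qquad \delta_{\mathrm C}+2\epsilon\,\mathfrak J\ \ge\ \Delta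 H_L .$$ -/

import Mathlib

open Filter Topology Asymptotics
open scoped Matrix ComplexOrder

namespace CovariantCode

noncomputable section

/-! Finite-dimensional systems are represented by finite index types (orthonormal bases), operators
by complex matrices, and maps between operator spaces by complex-linear maps. -/

/-- `ρ` is a density matrix: positive semidefinite with unit trace. -/
def IsDensity {n : Type*} [Fintype n] (ρ : Matrix n n ℂ) : Prop :=
  ρ.PosSemidef ∧ ρ.trace = 1

/-- The extension `Φ ⊗ 𝟙_R` of a linear map `Φ` between operator spaces to a reference system `R`. -/
def extend {m n : Type*} (Φ : Matrix m m ℂ →ₗ[ℂ] Matrix n n ℂ) (R : Type*)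
    (X : Matrix (m × R) (m × R) ℂ) : Matrix (n × R) (n × R) ℂ :=
  Matrix.of fun p q => Φ (Matrix.of fun i j => X (i, p.2) (j, q.2)) p.1 q.1

/-- Quantum channels: completely positive and trace-preserving linear maps. -/
def IsChannel {m n : Type*} [Fintype m] [Fintype n]
    (Φ : Matrix m m ℂ →ₗ[ℂ] Matrix n n ℂ) : Prop :=
  (∀ (k : ℕ) (X : Matrix (m × Fin k) (m × Fin k) ℂ),
      X.PosSemidef → (extend Φ (Fin k) X).PosSemidef) ∧
    ∀ X : Matrix m m ℂ, (Φ X).trace = X.trace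

/-- The map `ρ ↦ A ρ A†`. -/
def conjMap {m n : Type*} [Fintype m] (A : Matrix n m ℂ) :
    Matrix m m ℂ →ₗ[ℂ] Matrix n n ℂ where
  toFun ρ := A * ρ * Aᴴ
  map_add' ρ σ := by rw [Matrix.mul_add, Matrix.add_mul]
  map_smul' c ρ := by rw [Matrix.mul_smul, Matrix.smul_mul, RingHom.id_apply]

/-- The map `ρ ↦ ∑ i, K i ρ (K i)†` with Kraus operators `K`. -/
def krausMap {κ m n : Type*} [Fintype κ] [Fintype m] (K : κ → Matrix n m ℂ) :
    Matrix m m ℂ →ₗ[ℂ] Matrix n n ℂ :=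
  ∑ i, conjMap (K i)

/-- The dual map `Φ†`, determined by `Tr (H Φ(ρ)) = Tr (Φ†(H) ρ)`. -/
def dual {m n : Type*} [DecidableEq m] [Fintype n]
    (Φ : Matrix m m ℂ →ₗ[ℂ] Matrix n n ℂ) (H : Matrix n n ℂ) : Matrix m m ℂ :=
  Matrix.of fun i j => (H * Φ (Matrix.single j i 1)).trace

/-- The defining property of the dual map. -/
theorem trace_dual_mul {m n : Type*} [DecidableEq m] [Fintype m] [Fintype n]
    (Φ : Matrix m m ℂ →ₗ[ℂ] Matrix n n ℂ) (H : Matrix n n ℂ) (ρ : Matrix m m ℂ) :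
    (dual Φ H * ρ).trace = (H * Φ ρ).trace := by
  conv_rhs => rw [Matrix.matrix_eq_sum_single ρ]
  have h : ∀ i j, (H * Φ (Matrix.single i j (ρ i j))).trace
      = ρ i j * (H * Φ (Matrix.single i j 1)).trace := by
    intro i j
    have : Matrix.single i j (ρ i j) = ρ i j • Matrix.single i j (1 : ℂ) := by
      rw [Matrix.smul_single, smul_eq_mul, mul_one]
    rw [this, map_smul, Matrix.mul_smul, Matrix.trace_smul, smul_eq_mul]
  simp only [map_sum, Matrix.mul_sum, Matrix.trace_sum, h]
  rw [Finset.sum_comm]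
  simp only [Matrix.trace, Matrix.diag_apply, Matrix.mul_apply, dual, Matrix.of_apply, mul_comm]

/-- For Hermitian `A`: the difference between its maximum and minimum eigenvalues. -/
def spread {n : Type*} [Fintype n] [DecidableEq n] (A : Matrix n n ℂ) : ℝ :=
  sSup (spectrum ℝ A) - sInf (spectrum ℝ A)

/-- The fidelity of states, `f(ρ, σ) = Tr √(√ρ σ √ρ)`. -/
def stateFidelity {n : Type*} [Fintype n] [DecidableEq n] (ρ σ : Matrix n n ℂ) : ℝ :=
  (cfc Real.sqrt (cfc Real.sqrt ρ * σ * cfc Real.sqrt ρ)).trace.re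

/-- The worst-case fidelity of channels: the minimum of the fidelity of the outputs over all inputs
of the channels together with a reference system as large as their input system. -/
def channelFidelity {m n : Type*} [Fintype m] [Fintype n] [DecidableEq n] [DecidableEq m]
    (Φ₁ Φ₂ : Matrix m m ℂ →ₗ[ℂ] Matrix n n ℂ) : ℝ :=
  sInf {x : ℝ | ∃ ρ : Matrix (m × m) (m × m) ℂ, IsDensity ρ ∧
    x = stateFidelity (extend Φ₁ m ρ) (extend Φ₂ m ρ)}

/-- The purified distance of channels. -/
def purifiedDist {m n : Type*} [Fintype m] [Fintype n] [DecidableEq n] [DecidableEq m]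
    (Φ₁ Φ₂ : Matrix m m ℂ →ₗ[ℂ] Matrix n n ℂ) : ℝ :=
  Real.sqrt (1 - channelFidelity Φ₁ Φ₂ ^ 2)

/-- The worst-case error-correction inaccuracy `ε(𝒩, ℰ)`: the minimum over all recovery channels of
the purified distance between `ℛ ∘ 𝒩 ∘ ℰ` and the identity channel. -/
def qecInaccuracy {L S T : Type*} [Fintype L] [DecidableEq L] [Fintype T]
    (N : Matrix S S ℂ →ₗ[ℂ] Matrix T T ℂ) (E : Matrix L L ℂ →ₗ[ℂ] Matrix S S ℂ) : ℝ :=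
  sInf {x : ℝ | ∃ R : Matrix T T ℂ →ₗ[ℂ] Matrix L L ℂ, IsChannel R ∧
    x = purifiedDist (R ∘ₗ N ∘ₗ E) LinearMap.id}

/-- The unitary `exp(-i θ H)`. -/
def evolution {n : Type*} [Fintype n] [DecidableEq n] (H : Matrix n n ℂ) (θ : ℝ) : Matrix n n ℂ :=
  NormedSpace.exp ((-(Complex.I * (θ : ℂ))) • H)

/-- `f` has second derivative `s` at `x`, in the sense of a second-order Taylor expansion
`f (x + t) = f x + a t + (s / 2) t ^ 2 + o(t ^ 2)`. -/
def HasSecondDerivAt (f : ℝ → ℝ) (s x : ℝ) : Prop :=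
  ∃ a : ℝ, (fun t : ℝ => f (x + t) - f x - a * t - s / 2 * t ^ 2) =o[𝓝 0] fun t : ℝ => t ^ 2

/-- Agreement with the iterated derivative, wherever that one exists. -/
theorem hasSecondDerivAt_of_hasDerivAt_deriv {f : ℝ → ℝ} {s x : ℝ}
    (hf : ∀ᶠ y in 𝓝 x, DifferentiableAt ℝ f y) (h : HasDerivAt (deriv f) s x) :
    HasSecondDerivAt f s x := by
  refine ⟨deriv f x, ?_⟩
  have htend : Tendsto (fun t : ℝ => x + t) (𝓝 0) (𝓝 x) := by
    have : Continuous fun t : ℝ => x + t := by fun_prop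
    simpa using this.tendsto 0
  have hd : ∀ᶠ t in 𝓝 (0 : ℝ), HasDerivAt
      (fun t : ℝ => f (x + t) - f x - deriv f x * t - s / 2 * t ^ 2)
      (deriv f (x + t) - deriv f x - s * t) t := by
    filter_upwards [htend.eventually hf] with t ht
    have h1 : HasDerivAt (fun t : ℝ => f (x + t)) (deriv f (x + t)) t := by
      simpa using ht.hasDerivAt.comp_const_add x t
    have h2 := ((h1.sub_const (f x)).sub ((hasDerivAt_id t).const_mul (deriv f x))).sub
      (((hasDerivAt_id t).pow 2).const_mul (s / 2))
    refine h2.congr_deriv ?_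
    simp only [id_eq]
    ring
  have hslope : Tendsto (fun t : ℝ => (deriv f (x + t) - deriv f x - s * t) / (2 * t)) (𝓝[≠] 0)
      (𝓝 0) := by
    have h3 := h.tendsto_slope_zero
    have h4 : Tendsto (fun t : ℝ => (t⁻¹ • (deriv f (x + t) - deriv f x) - s) / 2) (𝓝[≠] 0)
        (𝓝 0) := by
      simpa using (h3.sub_const s).div_const 2
    refine h4.congr' ?_
    filter_upwards [self_mem_nhdsWithin] with t ht
    have ht' : t ≠ 0 := ht
    simp only [smul_eq_mul]
    field_simp
  have hlim : Tendsto (fun t : ℝ => (f (x + t) - f x - deriv f x * t - s / 2 * t ^ 2) / t ^ 2)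
      (𝓝[≠] 0) (𝓝 0) := by
    refine HasDerivAt.lhopital_zero_nhdsNE (hd.filter_mono nhdsWithin_le_nhds)
      (g' := fun t : ℝ => 2 * t) ?_ ?_ ?_ ?_ hslope
    · exact Eventually.of_forall fun t => by simpa using hasDerivAt_pow 2 t
    · filter_upwards [self_mem_nhdsWithin] with t ht
      exact mul_ne_zero two_ne_zero ht
    · have := hd.self_of_nhds.continuousAt.tendsto
      simpa using this.mono_left nhdsWithin_le_nhds
    · have : Continuous fun t : ℝ => t ^ 2 := by fun_prop
      simpa using (this.tendsto 0).mono_left nhdsWithin_le_nhds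
  have hne : (fun t : ℝ => f (x + t) - f x - deriv f x * t - s / 2 * t ^ 2)
      =o[𝓝[≠] 0] fun t : ℝ => t ^ 2 := by
    rw [isLittleO_iff_tendsto']
    · exact hlim
    · filter_upwards [self_mem_nhdsWithin] with t ht h0
      exact absurd h0 (pow_ne_zero 2 ht)
  have hins := hne.insert (x := (0 : ℝ)) (by simp)
  have huniv : insert (0 : ℝ) {0}ᶜ = Set.univ := by
    ext y
    simp [em]
  rwa [huniv, nhdsWithin_univ] at hins

/-- The second derivative is unique. -/
theorem HasSecondDerivAt.unique {f : ℝ → ℝ} {s s' x : ℝ}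
    (h : HasSecondDerivAt f s x) (h' : HasSecondDerivAt f s' x) : s = s' := by
  obtain ⟨a, ha⟩ := h
  obtain ⟨b, hb⟩ := h'
  have key : ∀ {f : ℝ → ℝ} {s a : ℝ},
      (fun t : ℝ => f (x + t) - f x - a * t - s / 2 * t ^ 2) =o[𝓝 0] (fun t : ℝ => t ^ 2) →
      Tendsto (fun t : ℝ => (f (x + t) + f (x - t) - 2 * f x) / t ^ 2) (𝓝[≠] 0) (𝓝 s) := by
    intro f s a hl
    have hneg : Tendsto (fun t : ℝ => -t) (𝓝 0) (𝓝 0) := by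
      simpa using (continuous_neg (G := ℝ)).tendsto 0
    have h1 := hl.tendsto_div_nhds_zero
    have h2 := h1.comp hneg
    have h3 := ((h1.add h2).mono_left (nhdsWithin_le_nhds (s := {0}ᶜ))).add_const s
    simp only [add_zero, zero_add] at h3
    refine h3.congr' ?_
    filter_upwards [self_mem_nhdsWithin] with t ht
    have ht' : t ≠ 0 := ht
    simp only [Function.comp_apply, ← sub_eq_add_neg]
    field_simp
    ring
  exact tendsto_nhds_unique (key ha) (key hb)

open Classical in
/-- The second derivative of `f` at `x` (and `0` if it does not exist). -/
def secondDeriv (f : ℝ → ℝ) (x : ℝ) : ℝ :=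
  if h : ∃ s, HasSecondDerivAt f s x then h.choose else 0

/-- The squared purified distance `P(𝒰_{S,θ} ∘ ℰ ∘ 𝒰_{L,θ}†, ℰ)²` as a function of `θ`. -/
def covarianceDefect {L S : Type*} [Fintype L] [DecidableEq L] [Fintype S] [DecidableEq S]
    (E : Matrix L L ℂ →ₗ[ℂ] Matrix S S ℂ) (HL : Matrix L L ℂ) (HS : Matrix S S ℂ) (θ : ℝ) : ℝ :=
  purifiedDist (conjMap (evolution HS θ) ∘ₗ E ∘ₗ conjMap (evolution HL θ)ᴴ) E ^ 2

/-- The local (point) covariance violation `δ_P`. -/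
def localCovarianceViolation {L S : Type*} [Fintype L] [DecidableEq L] [Fintype S] [DecidableEq S]
    (E : Matrix L L ℂ →ₗ[ℂ] Matrix S S ℂ) (HL : Matrix L L ℂ) (HS : Matrix S S ℂ) : ℝ :=
  Real.sqrt (2 * secondDeriv (covarianceDefect E HL HS) 0)

/-- The charge conservation violation `δ_C = Δ(H_L - ℰ†(H_S))`. -/
def chargeViolation {L S : Type*} [Fintype L] [DecidableEq L] [Fintype S]
    (E : Matrix L L ℂ →ₗ[ℂ] Matrix S S ℂ) (HL : Matrix L L ℂ) (HS : Matrix S S ℂ) : ℝ :=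
  spread (HL - dual E HS)

/-- The Hamiltonian-in-Kraus-span condition `H ∈ span {K_i† K_j}`. -/
def HKS {κ S T : Type*} [Fintype T] (K : κ → Matrix T S ℂ) (H : Matrix S S ℂ) : Prop :=
  H ∈ Submodule.span ℂ (Set.range fun p : κ × κ => (K p.1)ᴴ * K p.2)

/-- `𝔍`: the minimum of `Δ h` over Hermitian `h` with `H = ∑ i j, h_ij K_i† K_j`. -/
def frakJ {κ S T : Type*} [Fintype κ] [DecidableEq κ] [Fintype T]
    (K : κ → Matrix T S ℂ) (H : Matrix S S ℂ) : ℝ :=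
  sInf {x : ℝ | ∃ h : Matrix κ κ ℂ, h.IsHermitian ∧
    H = ∑ i, ∑ j, h i j • ((K i)ᴴ * K j) ∧ x = spread h}

end

end CovariantCode

/-! Write `G = W† H_S W`, which is `ℰ†(H_S)`. The triangle inequality `Δ H_L ≤ Δ(H_L - G) + Δ G`
(`spread_le_add`) leaves two claims: `Δ G ≤ 2 ε 𝔍` (`spread_dual_le`) and `δ_C ≤ δ_P`
(`chargeViolation_le_localCovarianceViolation`).

For the first, put `B i = K i W`, so that `G = ∑ h_ij B_i† B_j`: the noise leaks the value of `G` to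
its environment, where it is read off as the expectation of `h`. Superpose the two extreme
eigenvectors of `G` equally, each flagged by an orthogonal reference state. After noise and
recovery, the correlation between the sign of the flag and `h` on the environment is `Δ G / 2`.
Perfect recovery would leave the environment in a product with system and reference, where this
correlation vanishes. The actual state overlaps such a product state with squared modulus at least
`1 - P²`, and a Cauchy–Schwarz estimate (`sum_re_sub_le`) bounds the correlation by `P Δ h`. Then
take infima over recoveries and over `h`.

For the second, the fidelity of two isometric channels is an infimum of `|Tr(ρ V† W)|` over logical
states (`channelFidelity_conjMap`). Its square is `1 - θ² q(ρ) + O(θ³)` uniformly in `ρ`, so the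
squared purified distance is `θ² sup q + O(θ³)` and `δ_P² = 4 sup q`. Since `q(ρ)` dominates the
variance of `H_L - G` in `ρ`, an equal mixture of extreme eigenvectors gives `4 sup q ≥ δ_C²`. -/

namespace CovariantCode

/-! ### Spread, operator norm and expectation values. -/

section Spread

open scoped Matrix.Norms.L2Operator

variable {n : Type*} [Fintype n] [DecidableEq n]

theorem exists_spread_eq [Nonempty n] {A : Matrix n n ℂ} (hA : A.IsHermitian) :
    ∃ i j, spread A = hA.eigenvalues i - hA.eigenvalues j ∧
      ∀ k, hA.eigenvalues j ≤ hA.eigenvalues k ∧ hA.eigenvalues k ≤ hA.eigenvalues i := by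
  obtain ⟨i, hi⟩ := Finite.exists_max hA.eigenvalues
  obtain ⟨j, hj⟩ := Finite.exists_min hA.eigenvalues
  refine ⟨i, j, ?_, fun k => ⟨hj k, hi k⟩⟩
  have h1 : IsGreatest (Set.range hA.eigenvalues) (hA.eigenvalues i) :=
    ⟨⟨i, rfl⟩, by rintro _ ⟨k, rfl⟩; exact hi k⟩
  have h2 : IsLeast (Set.range hA.eigenvalues) (hA.eigenvalues j) :=
    ⟨⟨j, rfl⟩, by rintro _ ⟨k, rfl⟩; exact hj k⟩
  rw [spread, hA.spectrum_real_eq_range_eigenvalues, h1.csSup_eq, h2.csInf_eq]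

/-- Diagonalise and shift by the midpoint of the extreme eigenvalues: no diagonal entry then exceeds
half the spread in modulus. This turns `spread` into an operator norm. -/
theorem exists_norm_sub_smul_one_le [Nonempty n] {A : Matrix n n ℂ} (hA : A.IsHermitian) :
    ∃ c : ℝ, ‖A - (c : ℂ) • (1 : Matrix n n ℂ)‖ ≤ spread A / 2 := by
  obtain ⟨i, j, hs, hk⟩ := exists_spread_eq hA
  set d := hA.eigenvalues
  let c : ℝ := (d i + d j) / 2
  refine ⟨c, ?_⟩
  let U := hA.eigenvectorUnitary
  have hU : (U : Matrix n n ℂ) * star (U : Matrix n n ℂ) = 1 := Unitary.mul_star_self_of_mem U.2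
  have hAU : A - (c : ℂ) • (1 : Matrix n n ℂ) = (U : Matrix n n ℂ) *
      Matrix.diagonal (fun k => (d k : ℂ) - c) * ((star U : unitary (Matrix n n ℂ)) : Matrix n n ℂ) := by
    have h1 : Matrix.diagonal (fun k => (d k : ℂ) - c) =
        Matrix.diagonal (fun k => (d k : ℂ)) - (c : ℂ) • (1 : Matrix n n ℂ) := by
      ext a b
      by_cases hab : a = b
      · subst hab; simp
      · simp [hab]
    have h2 := hA.spectral_theorem
    rw [Unitary.conjStarAlgAut_apply] at h2
    rw [h1, Matrix.mul_sub, Matrix.sub_mul, Matrix.mul_smul, Matrix.mul_one, Matrix.smul_mul,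
      Unitary.coe_star, hU]
    congr 1
  rw [hAU, CStarRing.norm_mul_coe_unitary, CStarRing.norm_coe_unitary_mul,
    Matrix.l2_opNorm_diagonal, hs]
  refine (pi_norm_le_iff_of_nonneg ?_).2 fun k => ?_
  · linarith [(hk i).1]
  · have := hk k
    rw [← Complex.ofReal_sub, Complex.norm_real, Real.norm_eq_abs, abs_le]
    constructor <;> simp only [c] <;> linarith

theorem spread_nonneg {A : Matrix n n ℂ} (hA : A.IsHermitian) : 0 ≤ spread A := by
  cases isEmpty_or_nonempty n
  -- In dimension zero the spectrum is empty and both real extrema default to `0`.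
  · rw [spread, hA.spectrum_real_eq_range_eigenvalues, Set.range_eq_empty, Real.sSup_empty,
      Real.sInf_empty, sub_zero]
  · obtain ⟨i, j, hs, hk⟩ := exists_spread_eq hA
    linarith [(hk i).1]

theorem norm_toLp_sq {m : Type*} [Fintype m] (u : m → ℂ) :
    ((‖WithLp.toLp 2 u‖ ^ 2 : ℝ) : ℂ) = star u ⬝ᵥ u := by
  have := inner_self_eq_norm_sq_to_K (𝕜 := ℂ) (WithLp.toLp 2 u)
  rw [EuclideanSpace.inner_eq_star_dotProduct, dotProduct_comm] at this
  rw [this]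
  simp

theorem norm_dotProduct_mulVec_le {m : Type*} [Fintype m] (X : Matrix m n ℂ) (u : m → ℂ) (v : n → ℂ) :
    ‖star u ⬝ᵥ (X *ᵥ v)‖ ≤ ‖X‖ * (‖WithLp.toLp 2 u‖ * ‖WithLp.toLp 2 v‖) := by
  have h := norm_inner_le_norm (𝕜 := ℂ) (WithLp.toLp 2 u) (WithLp.toLp 2 (X *ᵥ v))
  rw [EuclideanSpace.inner_eq_star_dotProduct, dotProduct_comm] at h
  refine h.trans ?_
  have h2 := Matrix.l2_opNorm_mulVec X (WithLp.toLp 2 v)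
  calc _ ≤ ‖WithLp.toLp 2 u‖ * (‖X‖ * ‖WithLp.toLp 2 v‖) := by gcongr; exact h2
    _ = _ := by ring

theorem re_sub_re_le_spread {A : Matrix n n ℂ} (hA : A.IsHermitian) {u v : n → ℂ}
    (hu : star u ⬝ᵥ u = 1) (hv : star v ⬝ᵥ v = 1) :
    (star u ⬝ᵥ (A *ᵥ u)).re - (star v ⬝ᵥ (A *ᵥ v)).re ≤ spread A := by
  cases isEmpty_or_nonempty n
  · simp [dotProduct] at hu
  obtain ⟨c, hc⟩ := exists_norm_sub_smul_one_le hA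
  have key : ∀ w : n → ℂ, star w ⬝ᵥ w = 1 → |(star w ⬝ᵥ (A *ᵥ w)).re - c| ≤ spread A / 2 := by
    intro w hw
    have h1 := norm_dotProduct_mulVec_le (A - (c : ℂ) • (1 : Matrix n n ℂ)) w w
    have h2 : ‖WithLp.toLp 2 w‖ * ‖WithLp.toLp 2 w‖ = 1 := by
      have := norm_toLp_sq w
      rw [hw] at this
      rw [← sq]
      exact_mod_cast this
    rw [h2, mul_one, Matrix.sub_mulVec, Matrix.smul_mulVec, Matrix.one_mulVec, dotProduct_sub,
      dotProduct_smul, hw] at h1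
    have h3 := (Complex.abs_re_le_norm _).trans (h1.trans hc)
    simpa using h3
  have h1 := abs_le.1 (key u hu)
  have h2 := abs_le.1 (key v hv)
  linarith

theorem eigenvectorBasis_dotProduct {A : Matrix n n ℂ} (hA : A.IsHermitian) (i j : n) :
    star (⇑(hA.eigenvectorBasis i) : n → ℂ) ⬝ᵥ ⇑(hA.eigenvectorBasis j) = if i = j then 1 else 0 := by
  have := orthonormal_iff_ite.1 hA.eigenvectorBasis.orthonormal i j
  rw [EuclideanSpace.inner_eq_star_dotProduct, dotProduct_comm] at this
  exact this

theorem eigenvectorBasis_dotProduct_mulVec {A : Matrix n n ℂ} (hA : A.IsHermitian) (i : n) :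
    star (⇑(hA.eigenvectorBasis i) : n → ℂ) ⬝ᵥ (A *ᵥ ⇑(hA.eigenvectorBasis i)) =
      hA.eigenvalues i := by
  rw [hA.mulVec_eigenvectorBasis, dotProduct_smul, eigenvectorBasis_dotProduct]
  simp

/-- Test `A - B` and `B` on the extreme eigenvectors of `A`. -/
theorem spread_le_add [Nonempty n] {A B : Matrix n n ℂ} (hA : A.IsHermitian) (hB : B.IsHermitian) :
    spread A ≤ spread (A - B) + spread B := by
  obtain ⟨i, j, hs, -⟩ := exists_spread_eq hA
  have hu := eigenvectorBasis_dotProduct hA i i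
  have hv := eigenvectorBasis_dotProduct hA j j
  rw [if_pos rfl] at hu hv
  have h1 := re_sub_re_le_spread (hA.sub hB) hu hv
  have h2 := re_sub_re_le_spread hB hu hv
  simp only [Matrix.sub_mulVec, dotProduct_sub, eigenvectorBasis_dotProduct_mulVec, Complex.sub_re,
    Complex.ofReal_re] at h1
  linarith

end Spread

/-! ### Density matrices as trace functionals. -/

section Density

open scoped Matrix.Norms.L2Operator

variable {n : Type*} [Fintype n]

theorem trace_vecMulVec_mul (v w : n → ℂ) (X : Matrix n n ℂ) :
    (Matrix.vecMulVec v w * X).trace = w ⬝ᵥ (X *ᵥ v) := by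
  rw [Matrix.vecMulVec_mul, Matrix.trace_vecMulVec, dotProduct_comm, Matrix.dotProduct_mulVec]

/-- A density matrix is a sum of rank-one terms whose squared norms add to one. The bound does not
involve `ρ`, which later makes Taylor remainders uniform over states. -/
theorem IsDensity.norm_trace_mul_le [DecidableEq n] {ρ : Matrix n n ℂ} (hρ : IsDensity ρ)
    (X : Matrix n n ℂ) : ‖(ρ * X).trace‖ ≤ ‖X‖ := by
  obtain ⟨m, v, hv⟩ := Matrix.posSemidef_iff_eq_sum_vecMulVec.1 hρ.1
  have h1 : ∑ i, ‖WithLp.toLp 2 (v i)‖ ^ 2 = 1 := by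
    have := hρ.2
    simp only [hv, Matrix.trace_sum, Matrix.trace_vecMulVec] at this
    rw [← Complex.ofReal_inj, Complex.ofReal_one, ← this, Complex.ofReal_sum]
    refine Finset.sum_congr rfl fun i _ => ?_
    rw [norm_toLp_sq, dotProduct_comm]
  rw [hv, Matrix.sum_mul, Matrix.trace_sum]
  simp only [trace_vecMulVec_mul]
  calc _ ≤ ∑ i, ‖X‖ * (‖WithLp.toLp 2 (v i)‖ * ‖WithLp.toLp 2 (v i)‖) :=
        norm_sum_le_of_le _ fun i _ => norm_dotProduct_mulVec_le X (v i) (v i)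
    _ = ‖X‖ := by
        rw [← Finset.mul_sum]
        simp only [← sq, h1, mul_one]

end Density

/-! ### Matrix square roots and the trace norm. -/

section SquareRoot

open scoped MatrixOrder

variable {n : Type*} [Fintype n] [DecidableEq n]

theorem posSemidef_cfc_sqrt (A : Matrix n n ℂ) : (cfc Real.sqrt A).PosSemidef :=
  Matrix.nonneg_iff_posSemidef.1 (cfc_nonneg fun x _ => Real.sqrt_nonneg x)

theorem cfc_sqrt_mul_self_of_posSemidef {A : Matrix n n ℂ} (hA : A.PosSemidef) :
    cfc Real.sqrt (A * A) = A := by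
  have hsa : IsSelfAdjoint A := hA.1
  rw [← pow_two, ← cfc_comp_pow Real.sqrt 2 A]
  have h0 : ∀ x ∈ spectrum ℝ A, 0 ≤ x := fun x hx =>
    spectrum_nonneg_of_nonneg (Matrix.nonneg_iff_posSemidef.2 hA) hx
  have h1 : cfc (fun x : ℝ => √(x ^ 2)) A = cfc id A :=
    cfc_congr fun x hx => Real.sqrt_sq (h0 x hx)
  rw [h1, cfc_id ℝ A]

theorem cfc_sqrt_mul_cfc_sqrt {A : Matrix n n ℂ} (hA : A.PosSemidef) :
    cfc Real.sqrt A * cfc Real.sqrt A = A := by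
  have hsa : IsSelfAdjoint A := hA.1
  have h0 : ∀ x ∈ spectrum ℝ A, 0 ≤ x := fun x hx =>
    spectrum_nonneg_of_nonneg (Matrix.nonneg_iff_posSemidef.2 hA) hx
  have h1 : cfc (fun x : ℝ => √x * √x) A = cfc id A :=
    cfc_congr fun x hx => Real.mul_self_sqrt (h0 x hx)
  rw [← cfc_mul Real.sqrt Real.sqrt A, h1, cfc_id ℝ A]

theorem trace_cfc_sqrt_vecMulVec (v : n → ℂ) :
    (cfc Real.sqrt (Matrix.vecMulVec v (star v))).trace.re = ‖WithLp.toLp 2 v‖ := by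
  set r := ‖WithLp.toLp 2 v‖ with hr
  have hN := norm_toLp_sq v
  rw [← hr] at hN
  push_cast at hN
  -- The square root is the projector-like matrix divided by the norm of `v`; for `r = 0` the
  -- convention `r⁻¹ = 0` keeps this true.
  have hsq : Matrix.vecMulVec v (star v) =
      ((r⁻¹ : ℝ) • Matrix.vecMulVec v (star v)) * ((r⁻¹ : ℝ) • Matrix.vecMulVec v (star v)) := by
    rw [Matrix.smul_mul, Matrix.mul_smul, Matrix.vecMulVec_mul_vecMulVec, ← hN]
    rcases eq_or_ne r 0 with h | h
    · have : v = 0 := by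
        have := norm_eq_zero.1 (hr.symm.trans h)
        simpa using this
      simp [this]
    · have hc : (r : ℂ) ≠ 0 := Complex.ofReal_ne_zero.2 h
      ext i j
      simp only [Matrix.smul_apply, Matrix.vecMulVec_apply, Pi.smul_apply, smul_eq_mul,
        Complex.real_smul, Complex.ofReal_inv]
      field_simp
  have hpsd : ((r⁻¹ : ℝ) • Matrix.vecMulVec v (star v)).PosSemidef :=
    (Matrix.posSemidef_vecMulVec_self_star v).smul (inv_nonneg.2 (norm_nonneg _))
  rw [hsq, cfc_sqrt_mul_self_of_posSemidef hpsd, Matrix.trace_smul, Matrix.trace_vecMulVec,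
    dotProduct_comm, ← hN, Complex.real_smul]
  rcases eq_or_ne r 0 with h | h
  · simp [h]
  · norm_cast
    field_simp

/-- In an eigenbasis `u i` of `P = √(C C†)`, the vector `C† u i` has norm equal to the eigenvalue,
so Cauchy–Schwarz bounds each diagonal entry of `C` by that eigenvalue. -/
theorem norm_trace_le_trace_cfc_sqrt (C : Matrix n n ℂ) :
    ‖C.trace‖ ≤ (cfc Real.sqrt (C * Cᴴ)).trace.re := by
  set P := cfc Real.sqrt (C * Cᴴ) with hPdef
  have hP : P.PosSemidef := posSemidef_cfc_sqrt _
  have hPP : P * P = C * Cᴴ := cfc_sqrt_mul_cfc_sqrt (Matrix.posSemidef_self_mul_conjTranspose C)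
  let u : n → n → ℂ := fun i => hP.1.eigenvectorBasis i
  have hu1 : ∀ i, ‖WithLp.toLp 2 (u i)‖ = 1 := fun i => hP.1.eigenvectorBasis.orthonormal.1 i
  have hCu : ∀ i, ‖WithLp.toLp 2 (Cᴴ *ᵥ u i)‖ = hP.1.eigenvalues i := by
    intro i
    have h0 : (0 : ℝ) ≤ hP.1.eigenvalues i := hP.eigenvalues_nonneg i
    have h1 : ‖WithLp.toLp 2 (Cᴴ *ᵥ u i)‖ ^ 2 = hP.1.eigenvalues i ^ 2 := by
      rw [← Complex.ofReal_inj, norm_toLp_sq, Matrix.star_mulVec, Matrix.conjTranspose_conjTranspose,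
        ← Matrix.dotProduct_mulVec, Matrix.mulVec_mulVec, ← hPP, ← Matrix.mulVec_mulVec,
        hP.1.mulVec_eigenvectorBasis, Matrix.mulVec_smul, hP.1.mulVec_eigenvectorBasis,
        dotProduct_smul, dotProduct_smul, eigenvectorBasis_dotProduct]
      simp [sq]
    exact (pow_left_inj₀ (norm_nonneg _) h0 two_ne_zero).1 h1
  have htr : C.trace = ∑ i, star (u i) ⬝ᵥ (C *ᵥ u i) := by
    have hU : (hP.1.eigenvectorUnitary : Matrix n n ℂ) *
        star (hP.1.eigenvectorUnitary : Matrix n n ℂ) = 1 :=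
      Unitary.mul_star_self_of_mem hP.1.eigenvectorUnitary.2
    have h1 : C.trace = (star (hP.1.eigenvectorUnitary : Matrix n n ℂ) * (C *
        (hP.1.eigenvectorUnitary : Matrix n n ℂ))).trace := by
      rw [Matrix.trace_mul_comm, Matrix.mul_assoc, hU, Matrix.mul_one]
    rw [h1, Matrix.trace]
    refine Finset.sum_congr rfl fun i _ => ?_
    simp only [Matrix.diag_apply, Matrix.mul_apply, Matrix.star_apply, dotProduct, Matrix.mulVec,
      Pi.star_apply, Matrix.IsHermitian.eigenvectorUnitary_apply, u]
  have hPt : P.trace.re = ∑ i, hP.1.eigenvalues i := by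
    rw [hP.1.trace_eq_sum_eigenvalues]
    simp
  rw [hPt, htr]
  refine norm_sum_le_of_le _ fun i _ => ?_
  have h2 := norm_inner_le_norm (𝕜 := ℂ) (WithLp.toLp 2 (Cᴴ *ᵥ u i)) (WithLp.toLp 2 (u i))
  rw [hCu, hu1, mul_one, EuclideanSpace.inner_eq_star_dotProduct, dotProduct_comm,
    Matrix.star_mulVec, Matrix.conjTranspose_conjTranspose, ← Matrix.dotProduct_mulVec] at h2
  exact h2

end SquareRoot

/-! ### Fidelity of states: pure arguments and an Uhlmann-type lower bound. -/

section Fidelity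

variable {n : Type*} [Fintype n] [DecidableEq n]

theorem stateFidelity_nonneg (ρ σ : Matrix n n ℂ) : 0 ≤ stateFidelity ρ σ := by
  have := (posSemidef_cfc_sqrt (cfc Real.sqrt ρ * σ * cfc Real.sqrt ρ)).trace_nonneg
  exact (Complex.nonneg_iff.1 this).1

/-- `√σ v v† √σ` has rank one, so the trace of its root is the norm of `√σ v`. -/
theorem stateFidelity_vecMulVec_right_sq {σ : Matrix n n ℂ} (hσ : σ.PosSemidef) (v : n → ℂ) :
    stateFidelity σ (Matrix.vecMulVec v (star v)) ^ 2 = (star v ⬝ᵥ (σ *ᵥ v)).re := by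
  have hs : (cfc Real.sqrt σ)ᴴ = cfc Real.sqrt σ := (posSemidef_cfc_sqrt σ).1
  have h1 : cfc Real.sqrt σ * Matrix.vecMulVec v (star v) * cfc Real.sqrt σ =
      Matrix.vecMulVec (cfc Real.sqrt σ *ᵥ v) (star (cfc Real.sqrt σ *ᵥ v)) := by
    rw [Matrix.mul_vecMulVec, Matrix.vecMulVec_mul, Matrix.star_mulVec, hs]
  rw [stateFidelity, h1, trace_cfc_sqrt_vecMulVec, ← Complex.ofReal_re (_ ^ 2), norm_toLp_sq,
    Matrix.star_mulVec, hs, ← Matrix.dotProduct_mulVec, Matrix.mulVec_mulVec,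
    cfc_sqrt_mul_cfc_sqrt hσ]

theorem stateFidelity_vecMulVec (v w : n → ℂ) :
    stateFidelity (Matrix.vecMulVec v (star v)) (Matrix.vecMulVec w (star w)) = ‖star v ⬝ᵥ w‖ := by
  have h := stateFidelity_vecMulVec_right_sq (Matrix.posSemidef_vecMulVec_self_star v) w
  refine (pow_left_inj₀ (stateFidelity_nonneg _ _) (norm_nonneg _) two_ne_zero).1 ?_
  have h2 : star w ⬝ᵥ v = star (star v ⬝ᵥ w) := by
    rw [← Matrix.star_dotProduct, dotProduct_comm]
  rw [h, Matrix.vecMulVec_mulVec, op_smul_eq_smul, dotProduct_smul, h2, smul_eq_mul,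
    Complex.star_def, Complex.mul_conj, Complex.ofReal_re, Complex.normSq_eq_norm_sq]

/-- As `V` is an isometry, square roots pass through conjugation by it. The fidelity becomes the
trace norm of `C = √ρ V† W √ρ`, which dominates `|Tr C|`. -/
theorem norm_trace_le_stateFidelity {m : Type*} [Fintype m] [DecidableEq m] {V W : Matrix n m ℂ}
    (hV : Vᴴ * V = 1) {ρ : Matrix m m ℂ} (hρ : ρ.PosSemidef) :
    ‖(ρ * (Vᴴ * W)).trace‖ ≤ stateFidelity (V * ρ * Vᴴ) (W * ρ * Wᴴ) := by
  set s := cfc Real.sqrt ρ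
  have hs : sᴴ = s := (posSemidef_cfc_sqrt ρ).1
  have hss : s * s = ρ := cfc_sqrt_mul_cfc_sqrt hρ
  have hsq : ∀ M : Matrix m m ℂ, V * M * Vᴴ * (V * M * Vᴴ) = V * (M * M) * Vᴴ := by
    intro M
    calc V * M * Vᴴ * (V * M * Vᴴ) = V * M * (Vᴴ * V) * M * Vᴴ := by simp only [Matrix.mul_assoc]
      _ = _ := by rw [hV, Matrix.mul_one]; simp only [Matrix.mul_assoc]
  have hroot : ∀ M : Matrix m m ℂ, M.PosSemidef → cfc Real.sqrt (V * M * Vᴴ) =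
      V * cfc Real.sqrt M * Vᴴ := by
    intro M hM
    have h := hsq (cfc Real.sqrt M)
    rw [cfc_sqrt_mul_cfc_sqrt hM] at h
    rw [← h]
    exact cfc_sqrt_mul_self_of_posSemidef ((posSemidef_cfc_sqrt M).mul_mul_conjTranspose_same V)
  set C := s * (Vᴴ * W) * s with hC
  have h1 : cfc Real.sqrt (V * ρ * Vᴴ) * (W * ρ * Wᴴ) * cfc Real.sqrt (V * ρ * Vᴴ) =
      V * (C * Cᴴ) * Vᴴ := by
    rw [hroot ρ hρ, hC]
    simp only [Matrix.conjTranspose_mul, Matrix.conjTranspose_conjTranspose, hs]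
    change V * s * Vᴴ * (W * ρ * Wᴴ) * (V * s * Vᴴ) = _
    rw [← hss]
    simp only [Matrix.mul_assoc]
  have h2 : (ρ * (Vᴴ * W)).trace = C.trace := by
    rw [hC, Matrix.trace_mul_comm (s * (Vᴴ * W)) s, ← Matrix.mul_assoc s s, hss]
  have h3 : ∀ M : Matrix m m ℂ, (V * M * Vᴴ).trace = M.trace := fun M => by
    rw [Matrix.trace_mul_comm, ← Matrix.mul_assoc, hV, Matrix.one_mul]
  rw [stateFidelity, h1, hroot _ (Matrix.posSemidef_self_mul_conjTranspose C), h3, h2]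
  exact norm_trace_le_trace_cfc_sqrt C

end Fidelity

/-! ### Adjoining a reference system. -/

section Extension

open scoped Kronecker

variable {m n R : Type*}

/-- The partial trace over the reference system. -/
def reduced [Fintype R] (ρ : Matrix (m × R) (m × R) ℂ) : Matrix m m ℂ :=
  Matrix.of fun i j => ∑ r, ρ (i, r) (j, r)

theorem trace_reduced [Fintype m] [Fintype R] (ρ : Matrix (m × R) (m × R) ℂ) : (reduced ρ).trace = ρ.trace := by
  simp [reduced, Matrix.trace, Fintype.sum_prod_type]

theorem trace_mul_kronecker_one [Fintype m] [Fintype R] [DecidableEq R] (ρ : Matrix (m × R) (m × R) ℂ) (A : Matrix m m ℂ) :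
    (ρ * (A ⊗ₖ (1 : Matrix R R ℂ))).trace = (reduced ρ * A).trace := by
  simp only [Matrix.trace, Matrix.diag_apply, Matrix.mul_apply, Fintype.sum_prod_type, reduced,
    Matrix.of_apply, Matrix.kroneckerMap_apply, Matrix.one_apply, mul_ite, mul_one, mul_zero,
    Finset.sum_ite_eq', Finset.mem_univ, if_true, Finset.sum_mul]
  exact Finset.sum_congr rfl fun i _ => Finset.sum_comm

theorem posSemidef_reduced [Fintype R] {ρ : Matrix (m × R) (m × R) ℂ} (hρ : ρ.PosSemidef) :
    (reduced ρ).PosSemidef := by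
  have h : reduced ρ = ∑ r, ρ.submatrix (fun i => (i, r)) (fun i => (i, r)) := by
    ext i j
    simp [reduced, Matrix.sum_apply]
  rw [h]
  exact Matrix.posSemidef_sum _ fun r _ => hρ.submatrix _

theorem isDensity_reduced [Fintype m] [Fintype R] {ρ : Matrix (m × R) (m × R) ℂ} (hρ : IsDensity ρ) :
    IsDensity (reduced ρ) :=
  ⟨posSemidef_reduced hρ.1, (trace_reduced ρ).trans hρ.2⟩

theorem extend_conjMap [Fintype m] [Fintype R] [DecidableEq R] (V : Matrix n m ℂ) (X : Matrix (m × R) (m × R) ℂ) :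
    extend (conjMap V) R X = (V ⊗ₖ (1 : Matrix R R ℂ)) * X * (V ⊗ₖ (1 : Matrix R R ℂ))ᴴ := by
  ext ⟨i, r⟩ ⟨j, s⟩
  simp only [extend, conjMap, LinearMap.coe_mk, AddHom.coe_mk, Matrix.of_apply, Matrix.mul_apply,
    Fintype.sum_prod_type, Matrix.conjTranspose_apply, Matrix.kroneckerMap_apply,
    Matrix.one_apply, mul_ite, ite_mul, zero_mul, mul_one, mul_zero, Finset.sum_ite_eq,
    Finset.mem_univ, if_true, apply_ite star, star_zero]

theorem extend_conjMap_vecMulVec [Fintype m] [Fintype R] [DecidableEq R] (V : Matrix n m ℂ) (v : m × R → ℂ) :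
    extend (conjMap V) R (Matrix.vecMulVec v (star v)) =
      Matrix.vecMulVec ((V ⊗ₖ (1 : Matrix R R ℂ)) *ᵥ v)
        (star ((V ⊗ₖ (1 : Matrix R R ℂ)) *ᵥ v)) := by
  rw [extend_conjMap, Matrix.mul_vecMulVec, Matrix.vecMulVec_mul, Matrix.star_mulVec]

theorem conjTranspose_kronecker_one_mul [Fintype R] [DecidableEq R] [Fintype n] (V W : Matrix n m ℂ) :
    (V ⊗ₖ (1 : Matrix R R ℂ))ᴴ * (W ⊗ₖ (1 : Matrix R R ℂ)) =
      (Vᴴ * W) ⊗ₖ (1 : Matrix R R ℂ) := by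
  rw [Matrix.conjTranspose_kronecker, ← Matrix.mul_kronecker_mul, Matrix.conjTranspose_one,
    Matrix.mul_one]

theorem extend_krausMap [Fintype m] {κ : Type*} [Fintype κ] (K : κ → Matrix n m ℂ)
    (X : Matrix (m × R) (m × R) ℂ) :
    extend (krausMap K) R X = ∑ i, extend (conjMap (K i)) R X := by
  ext p q
  simp [extend, krausMap, Matrix.sum_apply]

theorem posSemidef_extend_krausMap [Fintype m] [Fintype R] [DecidableEq R] [Fintype n] {κ : Type*} [Fintype κ] (K : κ → Matrix n m ℂ)
    {X : Matrix (m × R) (m × R) ℂ} (hX : X.PosSemidef) : (extend (krausMap K) R X).PosSemidef := by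
  rw [extend_krausMap]
  refine Matrix.posSemidef_sum _ fun i _ => ?_
  rw [extend_conjMap]
  exact hX.mul_mul_conjTranspose_same _

end Extension

/-! ### Kraus representations of channels. -/

section Kraus

variable {m n : Type*} [Fintype m] [Fintype n]

theorem trace_conjMap (A : Matrix n m ℂ) (X : Matrix m m ℂ) :
    (conjMap A X).trace = (Aᴴ * A * X).trace := by
  change (A * X * Aᴴ).trace = _
  rw [Matrix.trace_mul_comm, ← Matrix.mul_assoc]

theorem isChannel_krausMap [DecidableEq m] {κ : Type*} [Fintype κ] {K : κ → Matrix n m ℂ}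
    (hK : ∑ i, (K i)ᴴ * K i = 1) : IsChannel (krausMap K) := by
  refine ⟨fun k X hX => posSemidef_extend_krausMap K hX, fun X => ?_⟩
  rw [krausMap, LinearMap.sum_apply, Matrix.trace_sum]
  simp only [trace_conjMap]
  rw [← Matrix.trace_sum, ← Finset.sum_mul, hK, Matrix.one_mul]

theorem krausMap_single_apply {m n : Type*} [Fintype m] [DecidableEq m] {κ : Type*} [Fintype κ] (K : κ → Matrix n m ℂ)
    (i j : m) (a b : n) :
    krausMap K (Matrix.single i j 1) a b = ∑ k, K k a i * star (K k b j) := by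
  simp only [krausMap, LinearMap.sum_apply, Matrix.sum_apply]
  refine Finset.sum_congr rfl fun k _ => ?_
  change (K k * Matrix.single i j (1 : ℂ) * (K k)ᴴ) a b = _
  rw [Matrix.mul_apply, Finset.sum_eq_single j]
  · rw [Matrix.mul_single_apply_same, mul_one, Matrix.conjTranspose_apply]
  · intro l _ hl
    rw [Matrix.mul_single_apply_of_ne _ _ _ _ _ hl, zero_mul]
  · simp

/-- Completely positive trace-preserving maps have a Kraus representation. -/
theorem IsChannel.exists_krausMap [DecidableEq m] {Φ : Matrix m m ℂ →ₗ[ℂ] Matrix n n ℂ}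
    (hΦ : IsChannel Φ) :
    ∃ (N : ℕ) (A : Fin N → Matrix n m ℂ), Φ = krausMap A ∧ ∑ i, (A i)ᴴ * A i = 1 := by
  let e := Fintype.equivFin m
  -- The unnormalised maximally entangled vector. Its image under the extended map is the Choi
  -- matrix; `e` is needed since `IsChannel` tests references of the form `Fin k`.
  let ω : m × Fin (Fintype.card m) → ℂ := fun p => if e p.1 = p.2 then 1 else 0
  have hpsd := hΦ.1 _ _ (Matrix.posSemidef_vecMulVec_self_star ω)
  obtain ⟨N, v, hv⟩ := Matrix.posSemidef_iff_eq_sum_vecMulVec.1 hpsd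
  have hentry : ∀ i j a b, Φ (Matrix.single i j 1) a b = ∑ k, v k (a, e i) * star (v k (b, e j)) := by
    intro i j a b
    have h1 := congrFun (congrFun hv (a, e i)) (b, e j)
    have h2 : (Matrix.of fun i' j' => Matrix.vecMulVec ω (star ω) (i', e i) (j', e j)) =
        Matrix.single i j (1 : ℂ) := by
      ext i' j'
      simp only [ω, Matrix.of_apply, Matrix.vecMulVec_apply, Pi.star_apply, Matrix.single_apply,
        EmbeddingLike.apply_eq_iff_eq]
      simp only [eq_comm (a := i'), eq_comm (a := j')]
      by_cases hi : i = i' <;> by_cases hj : j = j' <;> simp [hi, hj]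
    rw [extend, Matrix.of_apply] at h1
    simp only [h2] at h1
    rw [h1, Matrix.sum_apply]
    rfl
  -- Each vector in the rank-one decomposition of the Choi matrix is reshaped into a Kraus operator.
  let A : Fin N → Matrix n m ℂ := fun k => Matrix.of fun a i => v k (a, e i)
  have hΦA : Φ = krausMap A := by
    refine LinearMap.ext fun X => ?_
    rw [Matrix.matrix_eq_sum_single X]
    simp only [map_sum]
    refine Finset.sum_congr rfl fun i _ => Finset.sum_congr rfl fun j _ => ?_
    have h3 : Matrix.single i j (X i j) = X i j • Matrix.single i j (1 : ℂ) := by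
      rw [Matrix.smul_single, smul_eq_mul, mul_one]
    rw [h3, map_smul, map_smul]
    congr 1
    ext a b
    rw [hentry, krausMap_single_apply]
    rfl
  refine ⟨N, A, hΦA, ?_⟩
  ext j i
  -- Trace preservation on matrix units gives the entries of the normalisation identity.
  have h4 := hΦ.2 (Matrix.single i j 1)
  rw [hΦA, krausMap, LinearMap.sum_apply, Matrix.trace_sum] at h4
  simp only [trace_conjMap] at h4
  rw [← Matrix.trace_sum, ← Finset.sum_mul, Matrix.trace_mul_comm, Matrix.trace_single_mul] at h4
  simp only [one_smul] at h4
  rw [h4]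
  by_cases hij : i = j
  · subst hij; simp
  · rw [Matrix.trace_single_eq_of_ne _ _ _ hij, Matrix.one_apply_ne (Ne.symm hij)]

end Kraus

/-! ### Worst-case fidelity of isometric channels. -/

section ChannelFidelity

open scoped Kronecker

variable {m n : Type*} [Fintype m] [Fintype n] [DecidableEq n] [DecidableEq m]

theorem channelFidelity_nonneg (Φ₁ Φ₂ : Matrix m m ℂ →ₗ[ℂ] Matrix n n ℂ) :
    0 ≤ channelFidelity Φ₁ Φ₂ := by
  refine Real.sInf_nonneg ?_
  rintro _ ⟨ρ, -, rfl⟩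
  exact stateFidelity_nonneg _ _

theorem channelFidelity_le (Φ₁ Φ₂ : Matrix m m ℂ →ₗ[ℂ] Matrix n n ℂ)
    {ρ : Matrix (m × m) (m × m) ℂ} (hρ : IsDensity ρ) :
    channelFidelity Φ₁ Φ₂ ≤ stateFidelity (extend Φ₁ m ρ) (extend Φ₂ m ρ) := by
  refine csInf_le ⟨0, ?_⟩ ⟨ρ, hρ, rfl⟩
  rintro _ ⟨σ, -, rfl⟩
  exact stateFidelity_nonneg _ _

/-- The vector with amplitude matrix `√ρ` reduces to `√ρ √ρ† = ρ`, and its reference has exactly the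
size used in `channelFidelity`. -/
theorem IsDensity.exists_purification {ρ : Matrix m m ℂ} (hρ : IsDensity ρ) :
    ∃ v : m × m → ℂ, IsDensity (Matrix.vecMulVec v (star v)) ∧
      reduced (Matrix.vecMulVec v (star v)) = ρ := by
  let v : m × m → ℂ := fun p => cfc Real.sqrt ρ p.1 p.2
  have hred : reduced (Matrix.vecMulVec v (star v)) = ρ := by
    have hs : (cfc Real.sqrt ρ)ᴴ = cfc Real.sqrt ρ := (posSemidef_cfc_sqrt ρ).1
    conv_rhs => rw [← cfc_sqrt_mul_cfc_sqrt hρ.1]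
    conv_rhs => enter [2]; rw [← hs]
    ext i j
    simp [reduced, v, Matrix.mul_apply, Matrix.vecMulVec_apply]
  refine ⟨v, ⟨Matrix.posSemidef_vecMulVec_self_star v, ?_⟩, hred⟩
  rw [← trace_reduced, hred, hρ.2]

theorem exists_isDensity [Nonempty m] : ∃ ρ : Matrix m m ℂ, IsDensity ρ := by
  obtain ⟨i⟩ := ‹Nonempty m›
  refine ⟨Matrix.vecMulVec (Pi.single i 1) (star (Pi.single i 1)),
    Matrix.posSemidef_vecMulVec_self_star _, ?_⟩
  rw [Matrix.trace_vecMulVec]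
  simp

/-- The worst-case fidelity of two isometric channels is the distance of the numerical range of
`V† W` from the origin. -/
theorem channelFidelity_conjMap [Nonempty m] {V W : Matrix n m ℂ} (hV : Vᴴ * V = 1) :
    channelFidelity (conjMap V) (conjMap W) =
      sInf {x : ℝ | ∃ ρ : Matrix m m ℂ, IsDensity ρ ∧ x = ‖(ρ * (Vᴴ * W)).trace‖} := by
  obtain ⟨ρ₀, hρ₀⟩ := exists_isDensity (m := m)
  apply le_antisymm
  -- Upper bound: a purification of `ρ` makes both outputs pure, with overlap `Tr(ρ V† W)`.
  · refine le_csInf ⟨_, ρ₀, hρ₀, rfl⟩ ?_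
    rintro _ ⟨ρ, hρ, rfl⟩
    obtain ⟨v, hv, hred⟩ := hρ.exists_purification
    refine (channelFidelity_le _ _ hv).trans_eq ?_
    rw [extend_conjMap_vecMulVec, extend_conjMap_vecMulVec, stateFidelity_vecMulVec,
      Matrix.star_mulVec, ← Matrix.dotProduct_mulVec, Matrix.mulVec_mulVec,
      conjTranspose_kronecker_one_mul, ← trace_vecMulVec_mul, trace_mul_kronecker_one, hred]
  -- Lower bound: for an arbitrary, possibly mixed input, compare with its reduced state.
  · obtain ⟨σ₀, hσ₀⟩ := exists_isDensity (m := m × m)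
    refine le_csInf ⟨_, σ₀, hσ₀, rfl⟩ ?_
    rintro _ ⟨σ, hσ, rfl⟩
    rw [extend_conjMap, extend_conjMap]
    have hVk : (V ⊗ₖ (1 : Matrix m m ℂ))ᴴ * (V ⊗ₖ (1 : Matrix m m ℂ)) = 1 := by
      rw [conjTranspose_kronecker_one_mul, hV, Matrix.one_kronecker_one]
    refine le_trans (csInf_le ⟨0, ?_⟩ ⟨reduced σ, isDensity_reduced hσ, rfl⟩)
      ((norm_trace_le_stateFidelity hVk hσ.1 (W := W ⊗ₖ (1 : Matrix m m ℂ))).trans' (le_of_eq ?_))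
    · rintro _ ⟨ρ, -, rfl⟩
      exact norm_nonneg _
    · rw [conjTranspose_kronecker_one_mul, trace_mul_kronecker_one]

end ChannelFidelity

/-! ### Expectation values of nearby families of vectors. -/

section Comparison

open scoped Matrix.Norms.L2Operator

variable {ι κ : Type*} [Fintype ι] [Fintype κ]

/-- The analogue of `a² - b² = (a - b)(a + b)`: the real parts of the two cross terms cancel. -/
theorem re_sub_re_eq_of_isHermitian {h : Matrix κ κ ℂ}
    (hh : h.IsHermitian) (x y : κ → ℂ) :
    (star x ⬝ᵥ (h *ᵥ x)).re - (star y ⬝ᵥ (h *ᵥ y)).re =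
      (star (x - y) ⬝ᵥ (h *ᵥ (x + y))).re := by
  have h1 : star y ⬝ᵥ (h *ᵥ x) = star (star x ⬝ᵥ (h *ᵥ y)) := by
    rw [← Matrix.star_dotProduct, Matrix.star_mulVec, ← Matrix.dotProduct_mulVec, hh.eq]
  rw [star_sub, Matrix.mulVec_add, sub_dotProduct, dotProduct_add, dotProduct_add, h1]
  simp only [Complex.sub_re, Complex.add_re, Complex.star_def, Complex.conj_re]
  ring

theorem norm_toLp_add_sq (x y : κ → ℂ) :
    ‖WithLp.toLp 2 (x + y)‖ ^ 2 =
      ‖WithLp.toLp 2 x‖ ^ 2 + ‖WithLp.toLp 2 y‖ ^ 2 + 2 * (star y ⬝ᵥ x).re := by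
  rw [WithLp.toLp_add, norm_add_sq (𝕜 := ℂ), ← inner_conj_symm,
    EuclideanSpace.inner_eq_star_dotProduct, dotProduct_comm]
  simp only [RCLike.re_to_complex, Complex.conj_re]
  ring

theorem norm_toLp_sub_sq (x y : κ → ℂ) :
    ‖WithLp.toLp 2 (x - y)‖ ^ 2 =
      ‖WithLp.toLp 2 x‖ ^ 2 + ‖WithLp.toLp 2 y‖ ^ 2 - 2 * (star y ⬝ᵥ x).re := by
  rw [sub_eq_add_neg, norm_toLp_add_sq, WithLp.toLp_neg, norm_neg, star_neg, neg_dotProduct,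
    Complex.neg_re]
  ring

/-- Two families of vectors with overlap `F` have nearly equal weighted expectation values. -/
theorem sum_re_sub_le [DecidableEq κ] {h : Matrix κ κ ℂ} (hh : h.IsHermitian) (z : ι → ℝ) (hz : ∀ s, |z s| ≤ 1)
    (x y : ι → κ → ℂ) (hx : ∑ s, ‖WithLp.toLp 2 (x s)‖ ^ 2 = 1)
    (hy : ∑ s, ‖WithLp.toLp 2 (y s)‖ ^ 2 ≤ 1) :
    ∑ s, z s * ((star (x s) ⬝ᵥ (h *ᵥ x s)).re - (star (y s) ⬝ᵥ (h *ᵥ y s)).re) ≤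
      2 * ‖h‖ * √(1 - (∑ s, star (y s) ⬝ᵥ x s).re ^ 2) := by
  set F := (∑ s, star (y s) ⬝ᵥ x s).re with hF
  set b := ∑ s, ‖WithLp.toLp 2 (y s)‖ ^ 2 with hb
  have hb0 : 0 ≤ b := Finset.sum_nonneg fun s _ => by positivity
  have hFs : ∑ s, (star (y s) ⬝ᵥ x s).re = F := by rw [hF, Complex.re_sum]
  have hm : ∑ s, ‖WithLp.toLp 2 (x s - y s)‖ ^ 2 = 1 + b - 2 * F := by
    simp only [norm_toLp_sub_sq, Finset.sum_sub_distrib, Finset.sum_add_distrib, hx, ← hb,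
      ← Finset.mul_sum, hFs]
  have hp : ∑ s, ‖WithLp.toLp 2 (x s + y s)‖ ^ 2 = 1 + b + 2 * F := by
    simp only [norm_toLp_add_sq, Finset.sum_add_distrib, hx, ← hb, ← Finset.mul_sum, hFs]
  have hm0 : 0 ≤ 1 + b - 2 * F := hm ▸ Finset.sum_nonneg fun s _ => by positivity
  calc _ ≤ ∑ s, ‖h‖ * (‖WithLp.toLp 2 (x s - y s)‖ * ‖WithLp.toLp 2 (x s + y s)‖) := by
        refine Finset.sum_le_sum fun s _ => ?_
        rw [re_sub_re_eq_of_isHermitian hh]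
        refine (le_abs_self _).trans ?_
        rw [abs_mul]
        have h1 := (Complex.abs_re_le_norm _).trans (norm_dotProduct_mulVec_le h (x s - y s) (x s + y s))
        calc _ ≤ 1 * _ := mul_le_mul_of_nonneg_right (hz s) (abs_nonneg _)
          _ ≤ _ := by rw [one_mul]; exact h1
    _ ≤ ‖h‖ * (√(1 + b - 2 * F) * √(1 + b + 2 * F)) := by
        rw [← Finset.mul_sum, ← hm, ← hp]
        exact mul_le_mul_of_nonneg_left (Real.sum_mul_le_sqrt_mul_sqrt _ _ _) (norm_nonneg _)
    _ ≤ ‖h‖ * (2 * √(1 - F ^ 2)) := by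
        refine mul_le_mul_of_nonneg_left ?_ (norm_nonneg _)
        rw [← Real.sqrt_mul hm0]
        have h2 : (2 : ℝ) * √(1 - F ^ 2) = √(2 ^ 2 * (1 - F ^ 2)) := by
          rw [Real.sqrt_mul (by positivity), Real.sqrt_sq (by norm_num)]
        rw [h2]
        apply Real.sqrt_le_sqrt
        -- Here `(1 + b)² - 4 F² ≤ 4 (1 - F²)`, because `0 ≤ b ≤ 1`.
        nlinarith
    _ = _ := by ring

end Comparison

/-! ### Composing encoding, noise and recovery. -/

section Recovery

open scoped Kronecker

variable {L S T κ r : Type*} [Fintype S] [Fintype κ] [Fintype r]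

theorem krausMap_comp_krausMap [Fintype T] (A : r → Matrix L T ℂ) (K : κ → Matrix T S ℂ) :
    krausMap A ∘ₗ krausMap K = krausMap fun p : r × κ => A p.1 * K p.2 := by
  refine LinearMap.ext fun X => ?_
  simp only [LinearMap.comp_apply, krausMap, LinearMap.sum_apply, map_sum, Fintype.sum_prod_type]
  rw [Finset.sum_comm]
  refine Finset.sum_congr rfl fun i _ => Finset.sum_congr rfl fun j _ => ?_
  change A i * (K j * X * (K j)ᴴ) * (A i)ᴴ = A i * K j * X * (A i * K j)ᴴ
  simp only [Matrix.conjTranspose_mul, Matrix.mul_assoc]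

theorem krausMap_comp_conjMap [Fintype L] (K : κ → Matrix T S ℂ) (W : Matrix S L ℂ) :
    krausMap K ∘ₗ conjMap W = krausMap fun i => K i * W := by
  refine LinearMap.ext fun X => ?_
  simp only [LinearMap.comp_apply, krausMap, LinearMap.sum_apply]
  refine Finset.sum_congr rfl fun i _ => ?_
  change K i * (W * X * Wᴴ) * (K i)ᴴ = K i * W * X * (K i * W)ᴴ
  simp only [Matrix.conjTranspose_mul, Matrix.mul_assoc]

variable [Fintype L]

/-- Inserting `∑ A_a† A_a = 1` between `B_i†` and `B_j` shows that recovery does not alter the state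
of the noise environment, so `h` keeps its expectation there. -/
theorem sum_star_dotProduct_mulVec_of_kraus [Fintype T] [DecidableEq T] {A : r → Matrix L T ℂ}
    (hA : ∑ i, (A i)ᴴ * A i = 1) (B : κ → Matrix T S ℂ) (h : Matrix κ κ ℂ) (φ : S → ℂ) :
    ∑ l, ∑ a, star (fun i => ((A a * B i) *ᵥ φ) l) ⬝ᵥ (h *ᵥ fun i => ((A a * B i) *ᵥ φ) l) =
      star φ ⬝ᵥ ((∑ i, ∑ j, h i j • ((B i)ᴴ * B j)) *ᵥ φ) := by
  have h1 : ∀ i j, star φ ⬝ᵥ (((B i)ᴴ * B j) *ᵥ φ) =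
      ∑ a, ∑ l, star (((A a * B i) *ᵥ φ) l) * ((A a * B j) *ᵥ φ) l := by
    intro i j
    calc star φ ⬝ᵥ (((B i)ᴴ * B j) *ᵥ φ)
        = star φ ⬝ᵥ (((B i)ᴴ * (∑ a, (A a)ᴴ * A a) * B j) *ᵥ φ) := by rw [hA, Matrix.mul_one]
      _ = ∑ a, star φ ⬝ᵥ (((A a * B i)ᴴ * (A a * B j)) *ᵥ φ) := by
          rw [Matrix.mul_sum, Matrix.sum_mul, Matrix.sum_mulVec, dotProduct_sum]
          refine Finset.sum_congr rfl fun a _ => ?_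
          simp only [Matrix.conjTranspose_mul, Matrix.mul_assoc]
      _ = _ := by
          refine Finset.sum_congr rfl fun a _ => ?_
          rw [← Matrix.mulVec_mulVec, Matrix.dotProduct_mulVec, ← Matrix.star_mulVec]
          rfl
  simp only [Matrix.sum_mulVec, Matrix.smul_mulVec, dotProduct_sum, dotProduct_smul, h1,
    smul_eq_mul]
  -- Opaque names for the entries keep `simp` from unfolding them.
  obtain ⟨X, hX⟩ : ∃ X : r → κ → L → ℂ, ∀ a i l, ((A a * B i) *ᵥ φ) l = X a i l :=
    ⟨_, fun _ _ _ => rfl⟩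
  simp only [hX]
  simp only [dotProduct, Matrix.mulVec, Finset.mul_sum, Pi.star_apply]
  have h2 : ∀ f : L → r → κ → κ → ℂ, ∑ l, ∑ a, ∑ i, ∑ j, f l a i j =
      ∑ i, ∑ j, ∑ a, ∑ l, f l a i j := by
    intro f
    calc _ = ∑ a, ∑ l, ∑ i, ∑ j, f l a i j := Finset.sum_comm
      _ = ∑ a, ∑ i, ∑ l, ∑ j, f l a i j := Finset.sum_congr rfl fun _ _ => Finset.sum_comm
      _ = ∑ i, ∑ a, ∑ l, ∑ j, f l a i j := Finset.sum_comm
      _ = ∑ i, ∑ a, ∑ j, ∑ l, f l a i j :=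
        Finset.sum_congr rfl fun _ _ => Finset.sum_congr rfl fun _ _ => Finset.sum_comm
      _ = _ := Finset.sum_congr rfl fun _ _ => Finset.sum_comm
  rw [h2]
  refine Finset.sum_congr rfl fun i _ => Finset.sum_congr rfl fun j _ =>
    Finset.sum_congr rfl fun a _ => Finset.sum_congr rfl fun l _ => ?_
  ring

variable [DecidableEq L]

theorem extend_id {L R : Type*} (X : Matrix (L × R) (L × R) ℂ) :
    extend (LinearMap.id : Matrix L L ℂ →ₗ[ℂ] Matrix L L ℂ) R X = X := rfl

/-- Any pure input bounds the worst case, and its squared fidelity with the output is the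
expectation of the output in `v`. -/
theorem channelFidelity_krausMap_id_sq_le (M : κ → Matrix L L ℂ) {v : L × L → ℂ}
    (hv : IsDensity (Matrix.vecMulVec v (star v))) :
    channelFidelity (krausMap M) LinearMap.id ^ 2 ≤
      ∑ i, ‖star v ⬝ᵥ ((M i ⊗ₖ (1 : Matrix L L ℂ)) *ᵥ v)‖ ^ 2 := by
  have h1 := pow_le_pow_left₀ (channelFidelity_nonneg _ _)
    (channelFidelity_le (krausMap M) LinearMap.id hv) 2
  rw [extend_id, stateFidelity_vecMulVec_right_sq (posSemidef_extend_krausMap M hv.1),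
    extend_krausMap, Matrix.sum_mulVec, dotProduct_sum, Complex.re_sum] at h1
  refine h1.trans_eq (Finset.sum_congr rfl fun i _ => ?_)
  rw [extend_conjMap_vecMulVec, Matrix.vecMulVec_mulVec, op_smul_eq_smul, dotProduct_smul,
    Matrix.star_dotProduct, smul_eq_mul, Complex.star_def, mul_comm, Complex.mul_conj,
    Complex.ofReal_re, Complex.normSq_eq_norm_sq]

end Recovery

/-! ### The recovery error limits what the environment learns. -/

section RecoveryBound

open scoped Kronecker Matrix.Norms.L2Operator

variable {L T κ r : Type*} [Fintype L] [DecidableEq L] [Fintype T] [DecidableEq T] [Fintype κ]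
  [DecidableEq κ] [Fintype r]

theorem dotProduct_kronecker_one_mulVec (M : Matrix L L ℂ) (v : L × L → ℂ) :
    star v ⬝ᵥ ((M ⊗ₖ (1 : Matrix L L ℂ)) *ᵥ v) =
      ∑ m, ∑ l, star (v (l, m)) * (M *ᵥ fun l' => v (l', m)) l := by
  simp only [dotProduct, Matrix.mulVec, Fintype.sum_prod_type, Pi.star_apply,
    Matrix.kroneckerMap_apply, Matrix.one_apply, mul_ite, ite_mul, mul_one, mul_zero, zero_mul,
    Finset.sum_ite_eq, Finset.mem_univ, if_true]
  exact Finset.sum_comm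

theorem sum_norm_sq_of_isDensity {L : Type*} [Fintype L] {v : L × L → ℂ} (hv : IsDensity (Matrix.vecMulVec v (star v))) :
    ∑ m, ∑ l, ‖v (l, m)‖ ^ 2 = 1 := by
  have h := hv.2
  rw [Matrix.trace_vecMulVec, dotProduct_comm, ← norm_toLp_sq, EuclideanSpace.norm_sq_eq,
    Fintype.sum_prod_type, Finset.sum_comm] at h
  exact_mod_cast h

/-- The left side is the correlation between the reference observable `z` and the environment
observable `h`. It vanishes in a product state once `z` has mean zero, so it is bounded by the
distance from the best product state. -/
theorem sum_mul_re_le_spread_mul [Nonempty κ] {A : r → Matrix L T ℂ} (hA : ∑ i, (A i)ᴴ * A i = 1)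
    {B : κ → Matrix T L ℂ} (hB : ∑ i, (B i)ᴴ * B i = 1) {h : Matrix κ κ ℂ} (hh : h.IsHermitian)
    {v : L × L → ℂ} (hv : IsDensity (Matrix.vecMulVec v (star v))) {z : L → ℝ}
    (hz : ∀ m, |z m| ≤ 1) (hz0 : ∑ m, z m * ∑ l, ‖v (l, m)‖ ^ 2 = 0) :
    ∑ m, z m * (star (fun l => v (l, m)) ⬝ᵥ
        ((∑ i, ∑ j, h i j • ((B i)ᴴ * B j)) *ᵥ fun l => v (l, m))).re ≤
      spread h * purifiedDist (krausMap fun p : r × κ => A p.1 * B p.2) LinearMap.id := by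
  obtain ⟨c, hc⟩ := exists_norm_sub_smul_one_le hh
  set h₀ := h - (c : ℂ) • (1 : Matrix κ κ ℂ) with hh₀
  have hherm : h₀.IsHermitian := by
    refine hh.sub ?_
    rw [Matrix.IsHermitian, Matrix.conjTranspose_smul, Matrix.conjTranspose_one]
    simp
  have hsum := sum_star_dotProduct_mulVec_of_kraus hA B
  obtain ⟨φ, hφ⟩ : ∃ φ : L → L → ℂ, ∀ m, φ m = fun l => v (l, m) := ⟨_, fun _ => rfl⟩
  have hφn : ∀ m, star (φ m) ⬝ᵥ φ m = ((∑ l, ‖v (l, m)‖ ^ 2 : ℝ) : ℂ) := by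
    intro m
    rw [← norm_toLp_sq, EuclideanSpace.norm_sq_eq, hφ]
  -- Actual state after recovery: `s` collects the reference, system and recovery Kraus indices; the
  -- remaining index is the noise environment.
  let x : L × L × r → κ → ℂ := fun s i => ((A s.2.2 * B i) *ᵥ φ s.1) s.2.1
  obtain ⟨C, hC⟩ : ∃ C : r → κ → ℂ, ∀ a i, C a i =
      star v ⬝ᵥ (((A a * B i) ⊗ₖ (1 : Matrix L L ℂ)) *ᵥ v) := ⟨_, fun _ _ => rfl⟩
  set N : ℝ := √(∑ a, ∑ i, ‖C a i‖ ^ 2) with hN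
  have hN0 : 0 ≤ ∑ a, ∑ i, ‖C a i‖ ^ 2 := by positivity
  have hNsq : N ^ 2 = ∑ a, ∑ i, ‖C a i‖ ^ 2 := Real.sq_sqrt hN0
  -- Normalising the overlaps `C` gives the environment vector whose product with `v` is closest to
  -- the actual state; the overlap is `N`. If `N = 0` then `w = 0`, hence only `≤ 1` in `hy`.
  let w : r → κ → ℂ := fun a i => (N⁻¹ : ℝ) * C a i
  let y : L × L × r → κ → ℂ := fun s => v (s.2.1, s.1) • w s.2.2
  have hx : ∑ s, ‖WithLp.toLp 2 (x s)‖ ^ 2 = 1 := by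
    rw [← Complex.ofReal_inj, Complex.ofReal_sum, Complex.ofReal_one]
    simp only [norm_toLp_sq, Fintype.sum_prod_type, x]
    have h1 : ∀ m, ∑ l, ∑ a, star (fun i => ((A a * B i) *ᵥ φ m) l) ⬝ᵥ
        (fun i => ((A a * B i) *ᵥ φ m) l) = ((∑ l, ‖v (l, m)‖ ^ 2 : ℝ) : ℂ) := by
      intro m
      have h2 := hsum 1 (φ m)
      simp only [Matrix.one_mulVec, Matrix.one_apply, ite_smul, one_smul, zero_smul,
        Finset.sum_ite_eq, Finset.mem_univ, if_true, hB] at h2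
      rw [h2, hφn]
    simp only [h1]
    rw [← Complex.ofReal_sum, sum_norm_sq_of_isDensity hv, Complex.ofReal_one]
  have hy : ∑ s, ‖WithLp.toLp 2 (y s)‖ ^ 2 ≤ 1 := by
    have h1 : ∀ s, ‖WithLp.toLp 2 (y s)‖ ^ 2 =
        ‖v (s.2.1, s.1)‖ ^ 2 * (N⁻¹ ^ 2 * ∑ i, ‖C s.2.2 i‖ ^ 2) := by
      intro s
      simp only [y, w, WithLp.toLp_smul, norm_smul, mul_pow, EuclideanSpace.norm_sq_eq, norm_mul,
        Complex.norm_real, Finset.mul_sum, Real.norm_eq_abs, sq_abs]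
    simp only [h1, Fintype.sum_prod_type]
    simp only [← Finset.mul_sum, ← Finset.sum_mul]
    rw [sum_norm_sq_of_isDensity hv, one_mul, ← hNsq, ← mul_pow]
    rcases eq_or_ne N 0 with h0 | h0
    · simp [h0]
    · rw [inv_mul_cancel₀ h0, one_pow]
  have hov : ∑ s, star (y s) ⬝ᵥ x s = N := by
    have h1 : ∀ m l a, star (y (m, l, a)) ⬝ᵥ x (m, l, a) =
        ∑ i, (N⁻¹ : ℝ) * (star (C a i) *
          (star (v (l, m)) * ((A a * B i) *ᵥ φ m) l)) := by
      intro m l a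
      simp only [dotProduct, x, y, w, Pi.star_apply, Pi.smul_apply, smul_eq_mul, star_mul']
      refine Finset.sum_congr rfl fun i _ => ?_
      rw [Complex.star_def, Complex.conj_ofReal]
      ring
    simp only [Fintype.sum_prod_type, h1]
    have h2 : ∀ f : L → L → r → κ → ℂ, ∑ m, ∑ l, ∑ a, ∑ i, f m l a i =
        ∑ a, ∑ i, ∑ m, ∑ l, f m l a i := by
      intro f
      calc _ = ∑ m, ∑ a, ∑ l, ∑ i, f m l a i := Finset.sum_congr rfl fun _ _ => Finset.sum_comm
        _ = ∑ a, ∑ m, ∑ l, ∑ i, f m l a i := Finset.sum_comm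
        _ = ∑ a, ∑ m, ∑ i, ∑ l, f m l a i :=
          Finset.sum_congr rfl fun _ _ => Finset.sum_congr rfl fun _ _ => Finset.sum_comm
        _ = _ := Finset.sum_congr rfl fun _ _ => Finset.sum_comm
    rw [h2]
    simp only [← Finset.mul_sum]
    have h3 : ∀ a i, ∑ m, ∑ l, star (v (l, m)) * ((A a * B i) *ᵥ φ m) l = C a i := by
      intro a i
      rw [hC, dotProduct_kronecker_one_mulVec]
      simp only [hφ]
    have h4 : ∀ a i, star (C a i) * C a i = ((‖C a i‖ ^ 2 : ℝ) : ℂ) := by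
      intro a i
      rw [Complex.star_def, mul_comm, Complex.mul_conj, Complex.normSq_eq_norm_sq]
    simp only [h3, h4]
    simp only [← Complex.ofReal_sum]
    rw [← hNsq, ← Complex.ofReal_mul, Complex.ofReal_inj]
    rcases eq_or_ne N 0 with h0 | h0
    · simp [h0]
    · field_simp
  -- In the product family the expectation factors, and the reference factor is zero by `hz0`.
  have hye : ∑ s : L × L × r, z s.1 * (star (y s) ⬝ᵥ (h₀ *ᵥ y s)).re = 0 := by
    have h1 : ∀ s, (star (y s) ⬝ᵥ (h₀ *ᵥ y s)).re =
        ‖v (s.2.1, s.1)‖ ^ 2 * (star (w s.2.2) ⬝ᵥ (h₀ *ᵥ w s.2.2)).re := by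
      intro s
      have h2 : star (y s) ⬝ᵥ (h₀ *ᵥ y s) =
          ((‖v (s.2.1, s.1)‖ ^ 2 : ℝ) : ℂ) * (star (w s.2.2) ⬝ᵥ (h₀ *ᵥ w s.2.2)) := by
        simp only [y]
        rw [star_smul, Matrix.mulVec_smul, smul_dotProduct, dotProduct_smul, smul_eq_mul,
          smul_eq_mul, ← mul_assoc, Complex.star_def, mul_comm (starRingEnd ℂ _), Complex.mul_conj,
          Complex.normSq_eq_norm_sq]
      rw [h2, Complex.re_ofReal_mul]
    simp only [h1, Fintype.sum_prod_type]
    simp only [← Finset.mul_sum, ← Finset.sum_mul]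
    simp only [← mul_assoc]
    rw [← Finset.sum_mul, hz0, zero_mul]
  -- The shift by `c` contributes `c` times the mean of `z`, again zero.
  have hxe : ∑ s : L × L × r, z s.1 * (star (x s) ⬝ᵥ (h₀ *ᵥ x s)).re =
      ∑ m, z m * (star (φ m) ⬝ᵥ ((∑ i, ∑ j, h i j • ((B i)ᴴ * B j)) *ᵥ φ m)).re := by
    have h1 : ∑ i, ∑ j, h₀ i j • ((B i)ᴴ * B j) =
        ∑ i, ∑ j, h i j • ((B i)ᴴ * B j) - (c : ℂ) • (1 : Matrix L L ℂ) := by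
      simp only [hh₀, Matrix.sub_apply, sub_smul, Finset.sum_sub_distrib, Matrix.smul_apply,
        smul_eq_mul, mul_smul, ← Finset.smul_sum, Matrix.one_apply, ite_smul, one_smul, zero_smul,
        Finset.sum_ite_eq, Finset.mem_univ, if_true, hB]
    have h2 : ∀ m, ∑ l, ∑ a, (star (x (m, l, a)) ⬝ᵥ (h₀ *ᵥ x (m, l, a))).re =
        (star (φ m) ⬝ᵥ ((∑ i, ∑ j, h i j • ((B i)ᴴ * B j)) *ᵥ φ m)).re -
          c * ∑ l, ‖v (l, m)‖ ^ 2 := by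
      intro m
      have h3 := congrArg Complex.re (hsum h₀ (φ m))
      simp only [Complex.re_sum] at h3
      simp only [x]
      rw [h3, h1, Matrix.sub_mulVec, dotProduct_sub, Matrix.smul_mulVec, Matrix.one_mulVec,
        dotProduct_smul, hφn, Complex.sub_re, smul_eq_mul, Complex.re_ofReal_mul,
        Complex.ofReal_re]
    simp only [Fintype.sum_prod_type]
    simp only [← Finset.mul_sum, h2, mul_sub, Finset.sum_sub_distrib]
    simp only [mul_left_comm (_ : ℝ) c]
    rw [← Finset.mul_sum, hz0, mul_zero, sub_zero]
  have hmain := sum_re_sub_le hherm (fun s : L × L × r => z s.1) (fun s => hz s.1) x y hx hy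
  simp only [mul_sub, Finset.sum_sub_distrib] at hmain
  rw [hye, hxe, sub_zero, hov, Complex.ofReal_re] at hmain
  simp only [hφ] at hmain
  refine hmain.trans ?_
  refine mul_le_mul (by linarith) (Real.sqrt_le_sqrt ?_) (Real.sqrt_nonneg _) (spread_nonneg hh)
  have hF := channelFidelity_krausMap_id_sq_le (fun p : r × κ => A p.1 * B p.2) hv
  rw [Fintype.sum_prod_type] at hF
  simp only [← hC, ← hNsq] at hF
  linarith

/-- Choose `v` as the flagged superposition of extreme eigenvectors and `z = ±1` on the two flags;
the correlation is then half the spread. -/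
theorem spread_kraus_le [Nonempty L] [Nonempty κ] {A : r → Matrix L T ℂ}
    (hA : ∑ i, (A i)ᴴ * A i = 1)
    {B : κ → Matrix T L ℂ} (hB : ∑ i, (B i)ᴴ * B i = 1) {h : Matrix κ κ ℂ} (hh : h.IsHermitian)
    (hG : (∑ i, ∑ j, h i j • ((B i)ᴴ * B j)).IsHermitian) :
    spread (∑ i, ∑ j, h i j • ((B i)ᴴ * B j)) ≤
      2 * purifiedDist (krausMap fun p : r × κ => A p.1 * B p.2) LinearMap.id * spread h := by
  obtain ⟨i₀, j₀, hs, -⟩ := exists_spread_eq hG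
  -- With a single index `z` could not have mean zero, but then the spread is zero.
  rcases eq_or_ne i₀ j₀ with h0 | h0
  · rw [hs, h0, sub_self]
    exact mul_nonneg (mul_nonneg zero_le_two (Real.sqrt_nonneg _)) (spread_nonneg hh)
  set G := ∑ i, ∑ j, h i j • ((B i)ᴴ * B j)
  let q : L → ℝ := fun m => (if m = i₀ then 1 / 2 else 0) + if m = j₀ then 1 / 2 else 0
  let z : L → ℝ := fun m => if m = i₀ then 1 else if m = j₀ then -1 else 0
  have hq : ∀ m, 0 ≤ q m := fun m => by simp only [q]; positivity
  have hzq : ∀ m, z m * q m = (if m = i₀ then 1 / 2 else 0) - if m = j₀ then 1 / 2 else 0 := by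
    intro m
    by_cases hi : m = i₀
    · have : m ≠ j₀ := by rw [hi]; exact h0
      simp [z, q, hi, h0]
    · by_cases hj : m = j₀ <;> simp [z, q, hi, hj, h0.symm]
  let v : L × L → ℂ := fun p => (√(q p.2) : ℂ) * hG.eigenvectorBasis p.2 p.1
  have hcol : ∀ m, (fun l => v (l, m)) = (√(q m) : ℂ) • ⇑(hG.eigenvectorBasis m) := fun m => rfl
  have hvn : ∀ m, ∑ l, ‖v (l, m)‖ ^ 2 = q m := by
    intro m
    simp only [v, norm_mul, mul_pow, ← Finset.mul_sum, Complex.norm_real, Real.norm_eq_abs, sq_abs,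
      Real.sq_sqrt (hq m)]
    rw [← EuclideanSpace.norm_sq_eq, hG.eigenvectorBasis.orthonormal.1]
    simp
  have hv : IsDensity (Matrix.vecMulVec v (star v)) := by
    refine ⟨Matrix.posSemidef_vecMulVec_self_star v, ?_⟩
    rw [Matrix.trace_vecMulVec, dotProduct_comm, ← norm_toLp_sq, EuclideanSpace.norm_sq_eq,
      Fintype.sum_prod_type, Finset.sum_comm]
    simp only [hvn]
    simp only [q, Finset.sum_add_distrib, Finset.sum_ite_eq', Finset.mem_univ, if_true]
    norm_num
  have hz : ∀ m, |z m| ≤ 1 := by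
    intro m
    simp only [z]
    split_ifs <;> simp
  have hz0 : ∑ m, z m * ∑ l, ‖v (l, m)‖ ^ 2 = 0 := by
    simp only [hvn, hzq, Finset.sum_sub_distrib, Finset.sum_ite_eq', Finset.mem_univ, if_true,
      sub_self]
  have hmain := sum_mul_re_le_spread_mul hA hB hh hv hz hz0
  have he : ∀ m, (star (fun l => v (l, m)) ⬝ᵥ (G *ᵥ fun l => v (l, m))).re =
      q m * hG.eigenvalues m := by
    intro m
    rw [hcol, star_smul, Matrix.mulVec_smul, smul_dotProduct, dotProduct_smul,
      eigenvectorBasis_dotProduct_mulVec, smul_eq_mul, smul_eq_mul, Complex.star_def,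
      Complex.conj_ofReal, ← Complex.ofReal_mul, ← Complex.ofReal_mul, Complex.ofReal_re,
      ← mul_assoc, Real.mul_self_sqrt (hq m)]
  change ∑ m, z m * (star (fun l => v (l, m)) ⬝ᵥ (G *ᵥ fun l => v (l, m))).re ≤ _ at hmain
  simp only [he] at hmain
  simp only [← mul_assoc, hzq, sub_mul, Finset.sum_sub_distrib, ite_mul, zero_mul,
    Finset.sum_ite_eq', Finset.mem_univ, if_true] at hmain
  rw [hs]
  linarith

end RecoveryBound

/-! ### Infima over recoveries and over Hermitian representations. -/

theorem le_mul_csInf {s : Set ℝ} (hs : s.Nonempty) {c t : ℝ} (hc : 0 ≤ c)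
    (h : ∀ x ∈ s, t ≤ c * x) : t ≤ c * sInf s := by
  rcases hc.eq_or_lt with rfl | hc
  · obtain ⟨x, hx⟩ := hs
    simpa using h x hx
  · rw [← div_le_iff₀' hc]
    exact le_csInf hs fun x hx => (div_le_iff₀' hc).2 (h x hx)

section Infima

theorem isHermitian_conjTranspose_mul_mul {L S : Type*} [Fintype S] {W : Matrix S L ℂ} {H : Matrix S S ℂ}
    (hH : H.IsHermitian) : (Wᴴ * H * W).IsHermitian := by
  simp only [Matrix.IsHermitian, Matrix.conjTranspose_mul, Matrix.conjTranspose_conjTranspose, hH.eq,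
    Matrix.mul_assoc]

theorem nonempty_of_sum_conjTranspose_mul_self {S T κ : Type*} [Fintype T] [Fintype κ] [Nonempty S]
    [DecidableEq S] {K : κ → Matrix T S ℂ}
    (hK : ∑ i, (K i)ᴴ * K i = 1) : Nonempty κ ∧ Nonempty T := by
  obtain ⟨s⟩ := ‹Nonempty S›
  have h1 := congrFun (congrFun hK s) s
  constructor <;> by_contra hn <;> rw [not_nonempty_iff] at hn <;>
    simp [Matrix.sum_apply, Matrix.mul_apply] at h1

theorem nonempty_of_conjTranspose_mul_self {L S : Type*} [Fintype S] [DecidableEq L] [Nonempty L]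
    {W : Matrix S L ℂ} (hW : Wᴴ * W = 1) : Nonempty S := by
  obtain ⟨l⟩ := ‹Nonempty L›
  have h1 := congrFun (congrFun hW l) l
  by_contra hn
  rw [not_nonempty_iff] at hn
  simp [Matrix.mul_apply] at h1

variable {L S T κ : Type*} [Fintype L] [DecidableEq L] [Fintype S] [Fintype T] [Fintype κ]

theorem dual_conjMap (W : Matrix S L ℂ) (H : Matrix S S ℂ) :
    dual (conjMap W) H = Wᴴ * H * W := by
  ext i j
  rw [dual, Matrix.of_apply]
  change (H * (W * Matrix.single j i (1 : ℂ) * Wᴴ)).trace = _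
  rw [← Matrix.mul_assoc, Matrix.trace_mul_comm, ← Matrix.mul_assoc, ← Matrix.mul_assoc,
    Matrix.trace_mul_single]
  simp

/-- Discard the input and prepare a fixed basis state. Without some channel, the infimum defining
`qecInaccuracy` would take the default value `0`. -/
theorem exists_isChannel [Nonempty L] : ∃ R : Matrix T T ℂ →ₗ[ℂ] Matrix L L ℂ, IsChannel R := by
  classical
  obtain ⟨l⟩ := ‹Nonempty L›
  refine ⟨_, isChannel_krausMap (K := fun t : T => (Matrix.single l t 1 : Matrix L T ℂ)) ?_⟩
  ext a b
  simp only [Matrix.conjTranspose_single, star_one, Matrix.single_mul_single_same, mul_one,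
    Matrix.sum_apply, Matrix.single_apply, Matrix.one_apply, ite_and, Finset.sum_ite_eq',
    Finset.mem_univ, if_true]

/-- Taking adjoints, the conjugate-transposed coefficients also represent `H`; average the two. Thus
the infimum in `frakJ` is over a nonempty set. -/
theorem HKS.exists_isHermitian {S T κ : Type*} [Fintype T] [Fintype κ] {K : κ → Matrix T S ℂ} {H : Matrix S S ℂ} (hH : H.IsHermitian)
    (h : HKS K H) :
    ∃ h : Matrix κ κ ℂ, h.IsHermitian ∧ H = ∑ i, ∑ j, h i j • ((K i)ᴴ * K j) := by
  obtain ⟨c, hc⟩ := (Submodule.mem_span_range_iff_exists_fun ℂ).1 h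
  rw [Fintype.sum_prod_type] at hc
  let g : Matrix κ κ ℂ := Matrix.of fun i j => c (i, j)
  have hg : H = ∑ i, ∑ j, g i j • ((K i)ᴴ * K j) := hc.symm
  have hg' : H = ∑ i, ∑ j, gᴴ i j • ((K i)ᴴ * K j) := by
    rw [← hH.eq, hg, Finset.sum_comm]
    simp only [Matrix.conjTranspose_sum, Matrix.conjTranspose_smul, Matrix.conjTranspose_mul,
      Matrix.conjTranspose_conjTranspose, Matrix.conjTranspose_apply]
  refine ⟨(2⁻¹ : ℂ) • (g + gᴴ), ?_, ?_⟩
  · rw [Matrix.IsHermitian, Matrix.conjTranspose_smul, Matrix.conjTranspose_add,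
      Matrix.conjTranspose_conjTranspose, add_comm]
    simp
  · simp only [Matrix.smul_apply, Matrix.add_apply, smul_assoc, ← Finset.smul_sum, add_smul,
      Finset.sum_add_distrib]
    rw [← hg, ← hg', ← two_smul ℂ, smul_smul]
    norm_num

variable [DecidableEq κ]

theorem spread_dual_le [Nonempty L] [DecidableEq S] {W : Matrix S L ℂ} (hW : Wᴴ * W = 1)
    {H : Matrix S S ℂ} (hH : H.IsHermitian) {K : κ → Matrix T S ℂ}
    (hK : ∑ i, (K i)ᴴ * K i = 1) (hHKS : HKS K H) :
    spread (dual (conjMap W) H) ≤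
      2 * qecInaccuracy (krausMap K) (conjMap W) * frakJ K H := by
  classical
  have : Nonempty S := nonempty_of_conjTranspose_mul_self hW
  have : Nonempty κ := (nonempty_of_sum_conjTranspose_mul_self hK).1
  have hε : 0 ≤ qecInaccuracy (krausMap K) (conjMap W) := by
    refine Real.sInf_nonneg ?_
    rintro _ ⟨R, -, rfl⟩
    exact Real.sqrt_nonneg _
  obtain ⟨h₀, hh₀, hH₀⟩ := hHKS.exists_isHermitian hH
  rw [frakJ]
  refine le_mul_csInf ?_ (mul_nonneg zero_le_two hε) ?_
  · exact ⟨_, h₀, hh₀, hH₀, rfl⟩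
  rintro _ ⟨h, hh, hHh, rfl⟩
  rw [mul_right_comm, qecInaccuracy]
  obtain ⟨R₀, hR₀⟩ := exists_isChannel (L := L) (T := T)
  refine le_mul_csInf ?_ (mul_nonneg zero_le_two (spread_nonneg hh)) ?_
  · exact ⟨_, R₀, hR₀, rfl⟩
  rintro _ ⟨R, hR, rfl⟩
  obtain ⟨N, A, rfl, hA⟩ := hR.exists_krausMap
  rw [krausMap_comp_conjMap, krausMap_comp_krausMap, mul_right_comm]
  have hB : ∑ i, (K i * W)ᴴ * (K i * W) = 1 := by
    simp only [Matrix.conjTranspose_mul, Matrix.mul_assoc, ← Matrix.mul_sum]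
    simp only [← Matrix.mul_assoc (K _)ᴴ, ← Matrix.sum_mul]
    rw [hK, Matrix.one_mul, hW]
  have hG : dual (conjMap W) H = ∑ i, ∑ j, h i j • ((K i * W)ᴴ * (K j * W)) := by
    rw [dual_conjMap, hHh]
    simp only [Matrix.conjTranspose_mul, Matrix.mul_sum, Matrix.sum_mul, Matrix.mul_smul,
      Matrix.smul_mul, Matrix.mul_assoc]
  have hGh : (dual (conjMap W) H).IsHermitian := by
    rw [dual_conjMap]
    exact isHermitian_conjTranspose_mul_mul hH
  rw [hG] at hGh ⊢
  exact spread_kraus_le hA hB hh hGh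

theorem spread_le_chargeViolation_add [Nonempty L] [DecidableEq S] {W : Matrix S L ℂ}
    (hW : Wᴴ * W = 1) {HL : Matrix L L ℂ} (hHL : HL.IsHermitian)
    {H : Matrix S S ℂ} (hH : H.IsHermitian) {K : κ → Matrix T S ℂ}
    (hK : ∑ i, (K i)ᴴ * K i = 1) (hHKS : HKS K H) :
    spread HL ≤ chargeViolation (conjMap W) HL H +
      2 * qecInaccuracy (krausMap K) (conjMap W) * frakJ K H := by
  have hGh : (dual (conjMap W) H).IsHermitian := by
    rw [dual_conjMap]
    exact isHermitian_conjTranspose_mul_mul hH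
  exact (spread_le_add hHL hGh).trans (add_le_add le_rfl (spread_dual_le hW hH hK hHKS))

end Infima

/-! ### Second-order expansions of the evolutions. -/

section Taylor

theorem isBigO_mul_sub_quadratic {R : Type*} [NormedRing R] [NormedAlgebra ℂ R]
    {f g : ℝ → R} {a b a' b' : R}
    (hf : (fun θ : ℝ => f θ - (1 + (θ : ℂ) • a + ((θ : ℂ) ^ 2) • b)) =O[𝓝 0] fun θ => θ ^ 3)
    (hg : (fun θ : ℝ => g θ - (1 + (θ : ℂ) • a' + ((θ : ℂ) ^ 2) • b')) =O[𝓝 0] fun θ => θ ^ 3) :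
    (fun θ : ℝ => f θ * g θ -
      (1 + (θ : ℂ) • (a + a') + ((θ : ℂ) ^ 2) • (b + b' + a * a'))) =O[𝓝 0] fun θ => θ ^ 3 := by
  have hbdd : ∀ {F : ℝ → R}, Continuous F → F =O[𝓝 0] fun _ => (1 : ℝ) := fun hF =>
    (hF.tendsto 0).isBigO_one ℝ
  have hcube : (fun θ : ℝ => θ ^ 3) =O[𝓝 0] fun _ => (1 : ℝ) := by
    have : Continuous fun θ : ℝ => θ ^ 3 := by fun_prop
    exact (this.tendsto 0).isBigO_one ℝ
  have hP : (fun θ : ℝ => 1 + (θ : ℂ) • a + ((θ : ℂ) ^ 2) • b) =O[𝓝 0] fun _ => (1 : ℝ) :=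
    hbdd (by fun_prop)
  have hP' : (fun θ : ℝ => 1 + (θ : ℂ) • a' + ((θ : ℂ) ^ 2) • b') =O[𝓝 0] fun _ => (1 : ℝ) :=
    hbdd (by fun_prop)
  have hg1 : g =O[𝓝 0] fun _ => (1 : ℝ) := by
    simpa using (hg.trans hcube).add hP'
  have hrem : (fun θ : ℝ => ((θ : ℂ) ^ 3) • (a * b' + b * a' + (θ : ℂ) • (b * b'))) =O[𝓝 0]
      fun θ => θ ^ 3 := by
    have h1 : (fun θ : ℝ => ((θ : ℂ) ^ 3)) =O[𝓝 0] fun θ : ℝ => θ ^ 3 :=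
      IsBigO.of_bound 1 (Eventually.of_forall fun θ => by simp)
    have h2 : (fun θ : ℝ => a * b' + b * a' + (θ : ℂ) • (b * b')) =O[𝓝 0] fun _ => (1 : ℝ) :=
      hbdd (by fun_prop)
    simpa using h1.smul h2
  have h1 := hf.mul hg1
  have h2 := hP.mul hg
  simp only [mul_one, one_mul] at h1 h2
  -- With Taylor polynomials `p`, `p'`, the error is `(f - p) g + p (g - p')` plus the part of `p
  -- p'` of degree at least three, which is `hrem`.
  refine ((h1.add h2).add hrem).congr_left fun θ => ?_
  simp only [sub_mul, mul_sub, add_mul, mul_add, one_mul, mul_one, smul_mul_assoc, mul_smul_comm,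
    smul_add, smul_smul]
  ring_nf
  module

open scoped Matrix.Norms.L2Operator

variable {n : Type*} [Fintype n] [DecidableEq n]

theorem isBigO_exp_sub_quadratic {R : Type*} [NormedRing R] [NormedAlgebra ℂ R] [CompleteSpace R] :
    (fun y : R => NormedSpace.exp y - (1 + y + (1 / 2 : ℂ) • y ^ 2)) =O[𝓝 0] fun y => ‖y‖ ^ 3 := by
  have h := (NormedSpace.exp_hasFPowerSeriesAt_zero (𝕂 := ℂ) (𝔸 := R)).isBigO_sub_partialSum_pow 3
  refine h.congr_left fun y => ?_
  simp [FormalMultilinearSeries.partialSum, Finset.sum_range_succ, NormedSpace.expSeries_apply_eq,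
    Nat.factorial]

theorem isBigO_evolution_sub (H : Matrix n n ℂ) :
    (fun θ : ℝ => evolution H θ - (1 + (θ : ℂ) • (-Complex.I • H) +
      ((θ : ℂ) ^ 2) • ((-(1 / 2) : ℂ) • (H * H)))) =O[𝓝 0] fun θ => θ ^ 3 := by
  have hlim : Tendsto (fun θ : ℝ => (-(Complex.I * (θ : ℂ))) • H) (𝓝 0) (𝓝 0) := by
    have : Continuous fun θ : ℝ => (-(Complex.I * (θ : ℂ))) • H := by fun_prop
    simpa using this.tendsto 0
  have h1 := (isBigO_exp_sub_quadratic (R := Matrix n n ℂ)).comp_tendsto hlim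
  have h2 : ((fun y : Matrix n n ℂ => ‖y‖ ^ 3) ∘ fun θ : ℝ => (-(Complex.I * (θ : ℂ))) • H) =O[𝓝 0]
      fun θ : ℝ => θ ^ 3 := by
    refine IsBigO.of_bound (‖H‖ ^ 3) (Eventually.of_forall fun θ => ?_)
    simp [norm_smul, mul_pow, mul_comm]
  refine (h1.trans h2).congr_left fun θ => ?_
  have h3 : (-(Complex.I * (θ : ℂ))) ^ 2 = -((θ : ℂ) ^ 2) := by
    rw [neg_sq, mul_pow, Complex.I_sq]
    ring
  simp only [Function.comp_apply, evolution]
  rw [smul_pow, h3, pow_two H, smul_smul, smul_smul, smul_smul]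
  rw [show (1 / 2 : ℂ) * -((θ : ℂ) ^ 2) = (θ : ℂ) ^ 2 * -(1 / 2) by ring,
    show -(Complex.I * (θ : ℂ)) = (θ : ℂ) * -Complex.I by ring]

theorem evolution_neg {H : Matrix n n ℂ} (hH : H.IsHermitian) (θ : ℝ) :
    evolution H (-θ) = (evolution H θ)ᴴ := by
  rw [evolution, evolution, ← Matrix.exp_conjTranspose, Matrix.conjTranspose_smul, hH.eq]
  simp

theorem evolution_neg_mul (H : Matrix n n ℂ) (θ : ℝ) : evolution H (-θ) * evolution H θ = 1 := by
  rw [evolution, evolution, ← Matrix.exp_add_of_commute, ← add_smul]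
  · simp
  · exact (Commute.refl H).smul_left _ |>.smul_right _

theorem conjTranspose_evolution_mul {H : Matrix n n ℂ} (hH : H.IsHermitian) (θ : ℝ) :
    (evolution H θ)ᴴ * evolution H θ = 1 := by
  rw [← evolution_neg hH, evolution_neg_mul]

theorem evolution_mul_conjTranspose {H : Matrix n n ℂ} (hH : H.IsHermitian) (θ : ℝ) :
    evolution H θ * (evolution H θ)ᴴ = 1 :=
  mul_eq_one_comm.1 (conjTranspose_evolution_mul hH θ)

theorem isBigO_conj_evolution_sub {m : Type*} [Fintype m] [DecidableEq m] {W : Matrix m n ℂ}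
    (hW : Wᴴ * W = 1) (H : Matrix m m ℂ) :
    (fun θ : ℝ => Wᴴ * evolution H (-θ) * W - (1 + (θ : ℂ) • (Complex.I • (Wᴴ * H * W)) +
      ((θ : ℂ) ^ 2) • ((-(1 / 2) : ℂ) • (Wᴴ * (H * H) * W)))) =O[𝓝 0] fun θ => θ ^ 3 := by
  have hneg : Tendsto (fun θ : ℝ => -θ) (𝓝 0) (𝓝 0) := by
    simpa using (continuous_neg (G := ℝ)).tendsto 0
  have h1 := (isBigO_evolution_sub H).comp_tendsto hneg
  have h2 : ((fun θ : ℝ => θ ^ 3) ∘ fun θ : ℝ => -θ) =O[𝓝 0] fun θ : ℝ => θ ^ 3 :=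
    IsBigO.of_bound 1 (Eventually.of_forall fun θ => by simp)
  refine IsBigO.trans (IsBigO.of_bound (‖Wᴴ‖ * ‖W‖) (Eventually.of_forall fun θ => ?_))
    (h1.trans h2)
  have h3 : Wᴴ * evolution H (-θ) * W - (1 + (θ : ℂ) • (Complex.I • (Wᴴ * H * W)) +
      ((θ : ℂ) ^ 2) • ((-(1 / 2) : ℂ) • (Wᴴ * (H * H) * W))) =
      Wᴴ * (evolution H (-θ) - (1 + ((-θ : ℝ) : ℂ) • (-Complex.I • H) +
        (((-θ : ℝ) : ℂ) ^ 2) • ((-(1 / 2) : ℂ) • (H * H)))) * W := by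
    simp only [Matrix.mul_sub, Matrix.sub_mul, Matrix.mul_add, Matrix.add_mul, Matrix.mul_smul,
      Matrix.smul_mul, Matrix.mul_one, hW, Complex.ofReal_neg, neg_sq, neg_smul, smul_neg, neg_neg,
      Matrix.mul_neg, Matrix.neg_mul]
  rw [h3]
  refine (Matrix.l2_opNorm_mul _ _).trans ?_
  refine (mul_le_mul_of_nonneg_right (Matrix.l2_opNorm_mul _ _) (norm_nonneg _)).trans_eq ?_
  simp only [Function.comp_apply]
  ring

end Taylor

/-! ### Passing a uniform expansion to the extremum. -/

section Extremum

/-- Since the error `e` is the same for all `i`, minimising `a` amounts to maximising `q`. -/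
theorem abs_sInf_sq_sub_le {ι : Type*} {p : ι → Prop} (hp : ∃ i, p i) {a q : ι → ℝ} {e θ : ℝ}
    (ha : ∀ i, 0 ≤ a i) (hq : BddAbove {x | ∃ i, p i ∧ x = q i})
    (h : ∀ i, p i → |a i ^ 2 - (1 - θ ^ 2 * q i)| ≤ e) :
    |sInf {x | ∃ i, p i ∧ x = a i} ^ 2 - (1 - θ ^ 2 * sSup {x | ∃ i, p i ∧ x = q i})| ≤ e := by
  set f := sInf {x | ∃ i, p i ∧ x = a i}
  set Q := sSup {x | ∃ i, p i ∧ x = q i}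
  obtain ⟨i₀, hi₀⟩ := hp
  have hf0 : 0 ≤ f := by
    refine Real.sInf_nonneg ?_
    rintro _ ⟨i, -, rfl⟩
    exact ha i
  have hfa : ∀ i, p i → f ^ 2 ≤ a i ^ 2 := fun i hi =>
    pow_le_pow_left₀ hf0 (csInf_le ⟨0, by rintro _ ⟨j, -, rfl⟩; exact ha j⟩ ⟨i, hi, rfl⟩) 2
  have h1 : θ ^ 2 * Q ≤ 1 + e - f ^ 2 := by
    have h2 : ∀ i, p i → θ ^ 2 * q i ≤ 1 + e - f ^ 2 := fun i hi => by
      have := (abs_le.1 (h i hi)).2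
      have := hfa i hi
      linarith
    rcases eq_or_ne θ 0 with rfl | hθ
    · simpa using h2 i₀ hi₀
    · have hθ2 : 0 < θ ^ 2 := by positivity
      rw [← le_div_iff₀' hθ2]
      refine csSup_le ⟨_, i₀, hi₀, rfl⟩ ?_
      rintro _ ⟨i, hi, rfl⟩
      exact (le_div_iff₀' hθ2).2 (h2 i hi)
  have h2 : 1 - θ ^ 2 * Q - e ≤ f ^ 2 := by
    have hne : {x | ∃ i, p i ∧ x = a i}.Nonempty := ⟨_, i₀, hi₀, rfl⟩
    -- Comparing `√(1 - θ² Q - e)` with the infimum needs no sign condition on the radicand.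
    refine (Real.sqrt_le_iff.1 (le_csInf hne ?_)).2
    rintro _ ⟨i, hi, rfl⟩
    refine Real.sqrt_le_iff.2 ⟨ha i, ?_⟩
    have h3 := (abs_le.1 (h i hi)).1
    have h4 : θ ^ 2 * q i ≤ θ ^ 2 * Q :=
      mul_le_mul_of_nonneg_left (le_csSup hq ⟨i, hi, rfl⟩) (sq_nonneg _)
    linarith
  rw [abs_le]
  constructor <;> linarith

/-- The linear term is purely imaginary, so it enters the squared modulus only through `θ² β²`; the
rest `d` is of order `θ²`. The constant depends only on the bounds `b`, `g`, `C`. -/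
theorem abs_normSq_quadratic_le {θ β C g b : ℝ} {γ e t : ℂ} (hθ : |θ| ≤ 1) (hβ : |β| ≤ b)
    (hγ : ‖γ‖ ≤ g) (he : ‖e‖ ≤ C * |θ| ^ 3)
    (ht : t = 1 - (θ : ℂ) * (Complex.I * β) + (θ : ℂ) ^ 2 * γ + e) :
    |‖t‖ ^ 2 - (1 + θ ^ 2 * (2 * γ.re + β ^ 2))| ≤
      (2 * C + 2 * (g + C) ^ 2 + 2 * b * (g + C)) * |θ| ^ 3 := by
  set τ := |θ| with hτ
  have hτ0 : 0 ≤ τ := abs_nonneg θ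
  have hb0 : 0 ≤ b := (abs_nonneg _).trans hβ
  set d := (θ : ℂ) ^ 2 * γ + e with hd
  have hC : 0 ≤ C * τ ^ 3 := (norm_nonneg _).trans he
  have hdn : ‖d‖ ≤ (g + C) * τ ^ 2 := by
    have h1 : ‖d‖ ≤ τ ^ 2 * ‖γ‖ + ‖e‖ := by
      refine (norm_add_le _ _).trans_eq ?_
      rw [norm_mul, norm_pow, Complex.norm_real, Real.norm_eq_abs]
    -- No sign of `C` is assumed; for `θ ≠ 0` it follows from `he`.
    have h2 : C * τ ^ 3 ≤ C * τ ^ 2 := by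
      rcases hτ0.eq_or_lt with h0 | h0
      · simp [← h0]
      · have hC0 : 0 ≤ C := by
          by_contra hneg
          have : C * τ ^ 3 < 0 := mul_neg_of_neg_of_pos (not_le.1 hneg) (by positivity)
          linarith
        exact mul_le_mul_of_nonneg_left (pow_le_pow_of_le_one hτ0 hθ (by norm_num)) hC0
    have h3 : τ ^ 2 * ‖γ‖ ≤ τ ^ 2 * g := mul_le_mul_of_nonneg_left hγ (sq_nonneg _)
    linarith
  have hid : ‖t‖ ^ 2 - (1 + θ ^ 2 * (2 * γ.re + β ^ 2)) = 2 * e.re + ‖d‖ ^ 2 - 2 * θ * β * d.im := by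
    have htd : t = 1 - (θ : ℂ) * (Complex.I * β) + d := by rw [ht, hd]; ring
    have hdr : d.re = θ ^ 2 * γ.re + e.re := by
      rw [hd, ← Complex.ofReal_pow, Complex.add_re, Complex.re_ofReal_mul]
    have htr : t.re = 1 + d.re := by rw [htd]; simp
    have hti : t.im = d.im - θ * β := by rw [htd]; simp; ring
    rw [← Complex.normSq_eq_norm_sq, ← Complex.normSq_eq_norm_sq, Complex.normSq_apply,
      Complex.normSq_apply, htr, hti, hdr]
    ring
  rw [hid]
  have h1 : |2 * e.re| ≤ 2 * (C * τ ^ 3) := by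
    rw [abs_mul, abs_two]
    linarith [Complex.abs_re_le_norm e]
  have h2 : ‖d‖ ^ 2 ≤ (g + C) ^ 2 * τ ^ 3 := by
    calc ‖d‖ ^ 2 ≤ ((g + C) * τ ^ 2) ^ 2 := pow_le_pow_left₀ (norm_nonneg _) hdn 2
      _ = (g + C) ^ 2 * τ ^ 4 := by ring
      _ ≤ _ := mul_le_mul_of_nonneg_left (pow_le_pow_of_le_one hτ0 hθ (by norm_num)) (sq_nonneg _)
  have h3 : |2 * θ * β * d.im| ≤ 2 * b * (g + C) * τ ^ 3 := by
    rw [abs_mul, abs_mul, abs_mul, abs_two, ← hτ]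
    calc 2 * τ * |β| * |d.im| ≤ 2 * τ * b * ((g + C) * τ ^ 2) := by
          gcongr
          exact (Complex.abs_im_le_norm d).trans hdn
      _ = _ := by ring
  have h4 := abs_le.1 h1
  have h5 := abs_le.1 h3
  have h6 : 0 ≤ (g + C) ^ 2 * τ ^ 3 := by positivity
  have h7 := sq_nonneg ‖d‖
  rw [abs_le]
  constructor <;> linarith

end Extremum

/-! ### The local covariance violation dominates the charge violation. -/

section LocalCovariance

open scoped Matrix.Norms.L2Operator

variable {L S : Type*} [Fintype L] [DecidableEq L] [Fintype S]

/-- The second-order coefficient of `1 - |Tr (ρ W† U_{S,θ} W U_{L,θ}†)|²` in `θ`. -/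
noncomputable def infidelityRate (W : Matrix S L ℂ) (HL : Matrix L L ℂ) (HS : Matrix S S ℂ)
    (ρ : Matrix L L ℂ) : ℝ :=
  (ρ * (HL * HL + Wᴴ * (HS * HS) * W - HL * (Wᴴ * HS * W) - Wᴴ * HS * W * HL)).trace.re -
    (ρ * (HL - Wᴴ * HS * W)).trace.re ^ 2

/-- The supremum of `infidelityRate` over all logical states. -/
noncomputable def maxInfidelityRate (W : Matrix S L ℂ) (HL : Matrix L L ℂ)
    (HS : Matrix S S ℂ) : ℝ :=
  sSup {x | ∃ ρ, IsDensity ρ ∧ x = infidelityRate W HL HS ρ}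

theorem bddAbove_infidelityRate (W : Matrix S L ℂ) (HL : Matrix L L ℂ) (HS : Matrix S S ℂ) :
    BddAbove {x | ∃ ρ, IsDensity ρ ∧ x = infidelityRate W HL HS ρ} := by
  refine ⟨‖HL * HL + Wᴴ * (HS * HS) * W - HL * (Wᴴ * HS * W) - Wᴴ * HS * W * HL‖, ?_⟩
  rintro _ ⟨ρ, hρ, rfl⟩
  rw [infidelityRate]
  have h1 := (Complex.re_le_norm _).trans (hρ.norm_trace_mul_le
    (HL * HL + Wᴴ * (HS * HS) * W - HL * (Wᴴ * HS * W) - Wᴴ * HS * W * HL))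
  linarith [sq_nonneg (ρ * (HL - Wᴴ * HS * W)).trace.re]

theorem trace_mul_conjTranspose_eq {n : Type*} [Fintype n] {ρ : Matrix n n ℂ} (hρ : ρ.IsHermitian)
    (X : Matrix n n ℂ) : (ρ * Xᴴ).trace = star (ρ * X).trace := by
  rw [← Matrix.trace_conjTranspose, Matrix.conjTranspose_mul, hρ.eq, Matrix.trace_mul_comm]

/-- The rate is at least the variance of `H_L - G`, and an equal mixture of two extreme eigenvectors
has variance `(λ_i² + λ_j²)/2 - ((λ_i + λ_j)/2)² = (λ_i - λ_j)²/4`. -/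
theorem sq_spread_div_four_le_maxInfidelityRate [Nonempty L] [DecidableEq S] {W : Matrix S L ℂ}
    (hW : Wᴴ * W = 1) {HL : Matrix L L ℂ} (hHL : HL.IsHermitian) {HS : Matrix S S ℂ}
    (hHS : HS.IsHermitian) :
    spread (HL - Wᴴ * HS * W) ^ 2 / 4 ≤ maxInfidelityRate W HL HS := by
  set G := Wᴴ * HS * W with hGdef
  have hG : G.IsHermitian := isHermitian_conjTranspose_mul_mul hHS
  have hB : (HL - G).IsHermitian := hHL.sub hG
  obtain ⟨i, j, hs, -⟩ := exists_spread_eq hB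
  -- The excess over `(H_L - G)²` is a positive operator measuring how far `H_S` moves vectors out
  -- of the code space.
  have hM : HL * HL + Wᴴ * (HS * HS) * W - HL * G - G * HL =
      (HL - G) * (HL - G) + (HS * W - W * G)ᴴ * (HS * W - W * G) := by
    have h1 : (HS * W - W * G)ᴴ * (HS * W - W * G) = Wᴴ * (HS * HS) * W - G * G := by
      have h2 : Wᴴ * (W * G) = G := by rw [← Matrix.mul_assoc, hW, Matrix.one_mul]
      have h3 : Wᴴ * (HS * W) = G := by rw [hGdef, Matrix.mul_assoc]
      have h4 : Wᴴ * (HS * (W * G)) = G * G := by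
        rw [← h3]
        simp only [Matrix.mul_assoc]
      simp only [Matrix.conjTranspose_sub, Matrix.conjTranspose_mul, hG.eq, hHS.eq, Matrix.sub_mul,
        Matrix.mul_sub, Matrix.mul_assoc, h2, h3, h4]
      abel
    rw [h1]
    simp only [Matrix.sub_mul, Matrix.mul_sub]
    abel
  let u : L → L → ℂ := fun k => hB.eigenvectorBasis k
  have huu : ∀ k, star (u k) ⬝ᵥ u k = 1 := fun k => by
    simpa using eigenvectorBasis_dotProduct hB k k
  have huB : ∀ k, star (u k) ⬝ᵥ ((HL - G) *ᵥ u k) = hB.eigenvalues k :=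
    eigenvectorBasis_dotProduct_mulVec hB
  have huM : ∀ k, hB.eigenvalues k ^ 2 ≤
      (star (u k) ⬝ᵥ ((HL * HL + Wᴴ * (HS * HS) * W - HL * G - G * HL) *ᵥ u k)).re := by
    intro k
    have h1 : star (u k) ⬝ᵥ (((HL - G) * (HL - G)) *ᵥ u k) = ((hB.eigenvalues k ^ 2 : ℝ) : ℂ) := by
      rw [← Matrix.mulVec_mulVec, hB.mulVec_eigenvectorBasis, Matrix.mulVec_smul, dotProduct_smul]
      change hB.eigenvalues k • (star (u k) ⬝ᵥ ((HL - G) *ᵥ u k)) = _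
      rw [huB]
      simp [sq]
    have h2 := (Matrix.posSemidef_conjTranspose_mul_self (HS * W - W * G)).re_dotProduct_nonneg (u k)
    rw [hM, Matrix.add_mulVec, dotProduct_add, h1, Complex.add_re, Complex.ofReal_re]
    exact le_add_of_nonneg_right h2
  let ρ : Matrix L L ℂ := (1 / 2 : ℝ) • (Matrix.vecMulVec (u i) (star (u i)) +
    Matrix.vecMulVec (u j) (star (u j)))
  have htr : ∀ X : Matrix L L ℂ, (ρ * X).trace =
      (1 / 2 : ℝ) • (star (u i) ⬝ᵥ (X *ᵥ u i) + star (u j) ⬝ᵥ (X *ᵥ u j)) := by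
    intro X
    simp only [ρ]
    rw [Matrix.smul_mul, Matrix.trace_smul, Matrix.add_mul, Matrix.trace_add, trace_vecMulVec_mul,
      trace_vecMulVec_mul]
  have hρ : IsDensity ρ := by
    refine ⟨((Matrix.posSemidef_vecMulVec_self_star _).add
      (Matrix.posSemidef_vecMulVec_self_star _)).smul (by norm_num), ?_⟩
    have := htr 1
    rw [Matrix.mul_one, Matrix.one_mulVec, Matrix.one_mulVec, huu, huu] at this
    rw [this, Complex.real_smul]
    norm_num
  have hle : infidelityRate W HL HS ρ ≤ maxInfidelityRate W HL HS :=
    le_csSup (bddAbove_infidelityRate W HL HS) ⟨ρ, hρ, rfl⟩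
  refine le_trans ?_ hle
  rw [infidelityRate, ← hGdef, htr, htr, huB, huB, hs, Complex.smul_re, Complex.smul_re,
    Complex.add_re, Complex.add_re, Complex.ofReal_re, Complex.ofReal_re, smul_eq_mul, smul_eq_mul]
  linarith [huM i, huM j]

/-- The first-order coefficient is `-i (H_L - G)`, with purely imaginary expectation. All constants
are operator norms, so one neighbourhood of `0` serves every `ρ`. -/
theorem abs_norm_trace_sq_sub_le {W : Matrix S L ℂ}
    {HL : Matrix L L ℂ} (hHL : HL.IsHermitian) {HS : Matrix S S ℂ} (hHS : HS.IsHermitian)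
    {A : ℝ → Matrix L L ℂ}
    (hA : (fun θ : ℝ => A θ - (1 + (θ : ℂ) • (-Complex.I • HL + Complex.I • (Wᴴ * HS * W)) +
      ((θ : ℂ) ^ 2) • ((-(1 / 2) : ℂ) • (HL * HL) + (-(1 / 2) : ℂ) • (Wᴴ * (HS * HS) * W) +
        (-Complex.I • HL) * (Complex.I • (Wᴴ * HS * W))))) =O[𝓝 0] fun θ => θ ^ 3) :
    ∃ c : ℝ, ∀ᶠ θ in 𝓝 (0 : ℝ), ∀ ρ : Matrix L L ℂ, IsDensity ρ →
      |‖(ρ * A θ).trace‖ ^ 2 - (1 - θ ^ 2 * infidelityRate W HL HS ρ)| ≤ c * |θ| ^ 3 := by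
  set G := Wᴴ * HS * W with hGdef
  have hG : G.IsHermitian := isHermitian_conjTranspose_mul_mul hHS
  have hB : (HL - G).IsHermitian := hHL.sub hG
  set b := (-(1 / 2) : ℂ) • (HL * HL) + (-(1 / 2) : ℂ) • (Wᴴ * (HS * HS) * W) +
        (-Complex.I • HL) * (Complex.I • G) with hb
  obtain ⟨C, hC⟩ := hA.bound
  refine ⟨2 * C + 2 * (‖b‖ + C) ^ 2 + 2 * ‖HL - G‖ * (‖b‖ + C), ?_⟩
  have hsmall : ∀ᶠ θ in 𝓝 (0 : ℝ), |θ| ≤ 1 := by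
    filter_upwards [Metric.closedBall_mem_nhds (0 : ℝ) one_pos] with θ hθ
    simpa using hθ
  filter_upwards [hC, hsmall] with θ hr hθ ρ hρ
  set R := A θ - (1 + (θ : ℂ) • (-Complex.I • HL + Complex.I • G) + ((θ : ℂ) ^ 2) • b) with hR
  have hβ : (ρ * (HL - G)).trace = (((ρ * (HL - G)).trace.re : ℝ) : ℂ) := by
    have h1 := trace_mul_conjTranspose_eq hρ.1.1 (HL - G)
    rw [hB.eq] at h1
    exact (Complex.conj_eq_iff_re.1 h1.symm).symm
  have hβn : |(ρ * (HL - G)).trace.re| ≤ ‖HL - G‖ :=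
    (Complex.abs_re_le_norm _).trans (hρ.norm_trace_mul_le _)
  have he : ‖(ρ * R).trace‖ ≤ C * |θ| ^ 3 := by
    refine (hρ.norm_trace_mul_le R).trans ?_
    rwa [norm_pow, Real.norm_eq_abs] at hr
  have ht : (ρ * A θ).trace = 1 - (θ : ℂ) * (Complex.I * ((ρ * (HL - G)).trace.re : ℝ)) +
      (θ : ℂ) ^ 2 * (ρ * b).trace + (ρ * R).trace := by
    have h1 : A θ = 1 + (θ : ℂ) • (-Complex.I • HL + Complex.I • G) + ((θ : ℂ) ^ 2) • b + R := by
      rw [hR]; abel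
    have h2 : -Complex.I • HL + Complex.I • G = -Complex.I • (HL - G) := by
      rw [smul_sub, neg_smul, neg_smul]; abel
    rw [h1, h2, ← hβ]
    simp only [Matrix.mul_add, Matrix.mul_smul, Matrix.trace_add, Matrix.trace_smul, Matrix.mul_one,
      hρ.2, smul_eq_mul]
    ring
  -- The operator in the rate is minus twice the Hermitian part of the second-order coefficient `b`.
  have hγ : infidelityRate W HL HS ρ = -(2 * (ρ * b).trace.re + (ρ * (HL - G)).trace.re ^ 2) := by
    have h1 : HL * HL + Wᴴ * (HS * HS) * W - HL * G - G * HL = -(b + bᴴ) := by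
      have h2 : b = (-(1 / 2) : ℂ) • (HL * HL) + (-(1 / 2) : ℂ) • (Wᴴ * (HS * HS) * W) + HL * G := by
        rw [hb, Matrix.smul_mul, Matrix.mul_smul, smul_smul]
        simp
      have h3 : (Wᴴ * (HS * HS) * W)ᴴ = Wᴴ * (HS * HS) * W := by
        refine (isHermitian_conjTranspose_mul_mul ?_).eq
        rw [Matrix.IsHermitian, Matrix.conjTranspose_mul, hHS.eq]
      rw [h2]
      simp only [Matrix.conjTranspose_add, Matrix.conjTranspose_smul, h3, Matrix.conjTranspose_mul,
        hHL.eq, hG.eq, star_neg, star_div₀, star_one, star_ofNat]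
      module
    rw [infidelityRate, ← hGdef, h1, Matrix.mul_neg, Matrix.trace_neg, Matrix.mul_add,
      Matrix.trace_add, trace_mul_conjTranspose_eq hρ.1.1, Complex.neg_re, Complex.add_re,
      Complex.star_def, Complex.conj_re]
    ring
  have hmain := abs_normSq_quadratic_le hθ hβn (hρ.norm_trace_mul_le b) he ht
  rw [hγ]
  convert hmain using 3
  ring

variable [DecidableEq S]

theorem exists_abs_covarianceDefect_sub_le [Nonempty L] {W : Matrix S L ℂ} (hW : Wᴴ * W = 1)
    {HL : Matrix L L ℂ} (hHL : HL.IsHermitian) {HS : Matrix S S ℂ} (hHS : HS.IsHermitian) :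
    ∃ c : ℝ, ∀ᶠ θ in 𝓝 (0 : ℝ), |covarianceDefect (conjMap W) HL HS θ -
      θ ^ 2 * maxInfidelityRate W HL HS| ≤ c * |θ| ^ 3 := by
  have hQ : 0 ≤ maxInfidelityRate W HL HS :=
    le_trans (by positivity) (sq_spread_div_four_le_maxInfidelityRate hW hHL hHS)
  obtain ⟨c, hc⟩ := abs_norm_trace_sq_sub_le hHL hHS
    (isBigO_mul_sub_quadratic (isBigO_evolution_sub HL) (isBigO_conj_evolution_sub hW HS))
  refine ⟨c, hc.mono fun θ hθ => ?_⟩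
  have hcomp : conjMap (evolution HS θ) ∘ₗ conjMap W ∘ₗ conjMap (evolution HL θ)ᴴ =
      conjMap (evolution HS θ * W * (evolution HL θ)ᴴ) := by
    refine LinearMap.ext fun X => ?_
    simp [conjMap, Matrix.mul_assoc]
  have hV : (evolution HS θ * W * (evolution HL θ)ᴴ)ᴴ * (evolution HS θ * W * (evolution HL θ)ᴴ) =
      1 := by
    calc _ = evolution HL θ * (Wᴴ * ((evolution HS θ)ᴴ * evolution HS θ) * W) *
          (evolution HL θ)ᴴ := by
          simp only [Matrix.conjTranspose_mul, Matrix.conjTranspose_conjTranspose, Matrix.mul_assoc]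
      _ = 1 := by
          rw [conjTranspose_evolution_mul hHS, Matrix.mul_one, hW, Matrix.mul_one,
            evolution_mul_conjTranspose hHL]
  have hVW : (evolution HS θ * W * (evolution HL θ)ᴴ)ᴴ * W =
      evolution HL θ * (Wᴴ * evolution HS (-θ) * W) := by
    rw [evolution_neg hHS]
    simp only [Matrix.conjTranspose_mul, Matrix.conjTranspose_conjTranspose, Matrix.mul_assoc]
  have hf := abs_sInf_sq_sub_le (p := fun ρ : Matrix L L ℂ => IsDensity ρ) exists_isDensity
    (a := fun ρ => ‖(ρ * (evolution HL θ * (Wᴴ * evolution HS (-θ) * W))).trace‖)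
    (fun ρ => norm_nonneg _) (bddAbove_infidelityRate W HL HS) hθ
  rw [covarianceDefect, hcomp, purifiedDist, Real.sq_sqrt', channelFidelity_conjMap hV, hVW]
  change |_ ^ 2 - (1 - θ ^ 2 * maxInfidelityRate W HL HS)| ≤ _ at hf
  have h1 := abs_le.1 hf
  have h2 : 0 ≤ θ ^ 2 * maxInfidelityRate W HL HS := mul_nonneg (sq_nonneg _) hQ
  rw [abs_le]
  -- The real square root truncates `1 - f²` at `0`; this does not increase the error because `θ²`
  -- times the rate is nonnegative.
  rcases max_cases (1 - sInf {x | ∃ ρ : Matrix L L ℂ, IsDensity ρ ∧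
    x = ‖(ρ * (evolution HL θ * (Wᴴ * evolution HS (-θ) * W))).trace‖} ^ 2) 0 with h | h <;>
  · rw [h.1]
    constructor <;> linarith [h.2]

theorem hasSecondDerivAt_covarianceDefect [Nonempty L] {W : Matrix S L ℂ} (hW : Wᴴ * W = 1)
    {HL : Matrix L L ℂ} (hHL : HL.IsHermitian) {HS : Matrix S S ℂ} (hHS : HS.IsHermitian) :
    HasSecondDerivAt (covarianceDefect (conjMap W) HL HS) (2 * maxInfidelityRate W HL HS) 0 := by
  obtain ⟨c, hc⟩ := exists_abs_covarianceDefect_sub_le hW hHL hHS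
  -- The cubic bound, evaluated at `θ = 0`, forces the value there to vanish.
  have h0 : covarianceDefect (conjMap W) HL HS 0 = 0 := by
    have := hc.self_of_nhds
    simpa using this
  refine ⟨0, ?_⟩
  have h1 : (fun t : ℝ => covarianceDefect (conjMap W) HL HS (0 + t) -
      covarianceDefect (conjMap W) HL HS 0 - 0 * t -
        2 * maxInfidelityRate W HL HS / 2 * t ^ 2) =O[𝓝 0] fun t : ℝ => t ^ 3 := by
    refine IsBigO.of_bound c (hc.mono fun t ht => ?_)
    rw [zero_add, h0, sub_zero, zero_mul, sub_zero, norm_pow, Real.norm_eq_abs, Real.norm_eq_abs]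
    convert ht using 3
    ring
  exact h1.trans_isLittleO (isLittleO_pow_pow (by norm_num))

theorem chargeViolation_le_localCovarianceViolation [Nonempty L] {W : Matrix S L ℂ}
    (hW : Wᴴ * W = 1) {HL : Matrix L L ℂ} (hHL : HL.IsHermitian) {HS : Matrix S S ℂ}
    (hHS : HS.IsHermitian) :
    chargeViolation (conjMap W) HL HS ≤ localCovarianceViolation (conjMap W) HL HS := by
  have hderiv := hasSecondDerivAt_covarianceDefect hW hHL hHS
  have hex : ∃ s, HasSecondDerivAt (covarianceDefect (conjMap W) HL HS) s 0 := ⟨_, hderiv⟩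
  have hs : secondDeriv (covarianceDefect (conjMap W) HL HS) 0 = 2 * maxInfidelityRate W HL HS := by
    rw [secondDeriv, dif_pos hex]
    exact hex.choose_spec.unique hderiv
  rw [localCovarianceViolation, hs, chargeViolation, dual_conjMap]
  -- The radicand is `2 · 2` times the maximal rate, matching the `1/4` in the variance bound.
  apply Real.le_sqrt_of_sq_le
  linarith [sq_spread_div_four_le_maxInfidelityRate hW hHL hHS]

end LocalCovariance

end CovariantCode

theorem theorem19 {L S T κ : Type*} [Fintype L] [DecidableEq L] [Nonempty L]
    [Fintype S] [DecidableEq S] [Fintype T] [Fintype κ] [DecidableEq κ]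
    -- the encoding isometry
    (W : Matrix S L ℂ) (hW : Wᴴ * W = 1)
    -- the logical and physical Hamiltonians
    (HL : Matrix L L ℂ) (hHL : HL.IsHermitian) (HS : Matrix S S ℂ) (hHS : HS.IsHermitian)
    -- Kraus operators of the noise channel
    (K : κ → Matrix T S ℂ) (hK : ∑ i, (K i)ᴴ * K i = 1)
    (hHKS : CovariantCode.HKS K HS) :
    -- the second derivative that defines `δ_P` exists
    (∃ s, CovariantCode.HasSecondDerivAt
      (CovariantCode.covarianceDefect (CovariantCode.conjMap W) HL HS) s 0) ∧
    CovariantCode.spread HL ≤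
      CovariantCode.localCovarianceViolation (CovariantCode.conjMap W) HL HS +
        2 * CovariantCode.qecInaccuracy (CovariantCode.krausMap K) (CovariantCode.conjMap W) *
          CovariantCode.frakJ K HS ∧
    CovariantCode.spread HL ≤
      CovariantCode.chargeViolation (CovariantCode.conjMap W) HL HS +
        2 * CovariantCode.qecInaccuracy (CovariantCode.krausMap K) (CovariantCode.conjMap W) *
          CovariantCode.frakJ K HS := by
  exact ⟨⟨_, CovariantCode.hasSecondDerivAt_covarianceDefect hW hHL hHS⟩,
    (CovariantCode.spread_le_chargeViolation_add hW hHL hHS hK hHKS).trans (add_le_add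
      (CovariantCode.chargeViolation_le_localCovarianceViolation hW hHL hHS) le_rfl),
    CovariantCode.spread_le_chargeViolation_add hW hHL hHS hK hHKS⟩
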